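/- Let $p$ be a prime and let $F$ be a non-archimedean local field (a complete discretely valued field with finite residue field) of residue characteristic $p$, with ring of integers $\mathcal{O}$ and a fixed uniformizer $\varpi$. Let $\overline{\mathbb{F}}_p$ denote a fixed algebraically closed field of characteristic $p$. Put $G=\mathrm{GL}_2(F)$, $K=\mathrm{GL}_2(\mathcal{O})$, let $Z$ be the centre of $G$, and put $$\Pi=\begin{pmatrix}0&1\\ \varpi&0\end{pmatrix},\qquad P^+=\left\{\begin{pmatrix}a&b\\0&1\end{pmatrix}: a\in\mathcal{O}\setminus\{0\},\ b\in\mathcal{O}\right\}.$$ A weight is a smooth irreducible representation $\sigma$ of $KZ$ over $\overline{\mathbb{F}}_p$ (smooth: every vector is fixed by an open subgroup). Let $\mathrm{c\text{-}Ind}_{KZ}^G\sigma$ be the space of locally constant functions $f:G\to\sigma$, with compact support modulo $KZ$, such that $f(hg)=h\cdot f(g)$ for $h\in KZ$, $g\in G$, with $G$ acting by $(g'f)(g)=f(gg')$. For $g\in G$ and $v\in\sigma$ let $[g,v]\in\mathrm{c\text{-}Ind}_{KZ}^G\sigma$ be the function supported on $KZg^{-1}$ with value $v$ at $g^{-1}$.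 Let $I^+(\sigma)$ be the subspace spanned by the $[g,v]$ with $g\in P^+$, $v\in\sigma$, and let $I^-(\sigma)=\Pi\cdot I^+(\sigma)$. Let $\sigma$ be a weight, let $\mathrm{c\text{-}Ind}_{KZ}^G\sigma\twoheadrightarrow\pi$ be a nontrivial $G$-equivariant quotient, meaning that its kernel $R(\sigma,\pi)$ is nonzero, let $I^{+}(\sigma,\pi)$ and $I^{-}(\sigma,\pi)$ be the images of $I^{+}(\sigma)$ and $I^{-}(\sigma)$ in $\pi$, and let $D_1(\sigma,\pi)=I^+(\sigma,\pi)\cap I^-(\sigma,\pi)$. Then the following are equivalent: (i) $D_1(\sigma,\pi)$ is a finite-dimensional $\overline{\mathbb{F}}_p$-vector space; (ii) $R(\sigma,\pi)$ is finitely generated as an $\overline{\mathbb{F}}_p[G]$-module. -/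

import Mathlib

open scoped MonoidAlgebra ValuativeRel

noncomputable section

namespace ModpGL2

section General

variable {k G V : Type*} [Field k] [Group G] [TopologicalSpace G] [AddCommGroup V] [Module k V]

/-- A representation of a topological group is smooth if every vector is fixed by some open
subgroup. -/
def IsSmooth (ρ : Representation k G V) : Prop :=
  ∀ v : V, ∃ U : Subgroup G, IsOpen (U : Set G) ∧ ∀ u ∈ U, ρ u v = v

variable (H : Subgroup G) (σ : Representation k H V)

/-- The space of the compact induction `cInd_H^G σ`: the locally constant functions `f : G → V`
with compact support modulo `H` (the support lies in `H * C` for some compact set `C`) such that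
`f (h * g) = σ h (f g)` for `h` in `H` and `g` in `G`. -/
def cIndSpace [ContinuousMul G] : Submodule k (G → V) where
  carrier := {f | IsLocallyConstant f ∧
    (∃ C : Set G, IsCompact C ∧ ∀ g : G, f g ≠ 0 → ∃ h ∈ H, ∃ c ∈ C, g = h * c) ∧
    ∀ (h : H) (g : G), f (h * g) = σ h (f g)}
  zero_mem' := ⟨IsLocallyConstant.const 0, ⟨∅, isCompact_empty, fun _ hg => absurd rfl hg⟩,
    fun h _ => (map_zero (σ h)).symm⟩
  add_mem' := by
    rintro f₁ f₂ ⟨l₁, ⟨C₁, hC₁, s₁⟩, e₁⟩ ⟨l₂, ⟨C₂, hC₂, s₂⟩, e₂⟩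
    refine ⟨l₁.add l₂, ⟨C₁ ∪ C₂, hC₁.union hC₂, fun g hg => ?_⟩, fun h g => ?_⟩
    · by_cases h₁ : f₁ g = 0
      · have h₂ : f₂ g ≠ 0 := fun h₂ => hg (by simp [h₁, h₂])
        obtain ⟨h, hh, c, hc, rfl⟩ := s₂ g h₂
        exact ⟨h, hh, c, Or.inr hc, rfl⟩
      · obtain ⟨h, hh, c, hc, rfl⟩ := s₁ g h₁
        exact ⟨h, hh, c, Or.inl hc, rfl⟩
    · simp [e₁, e₂]
  smul_mem' := by
    rintro a f ⟨l, ⟨C, hC, s⟩, e⟩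
    refine ⟨l.comp (fun x => a • x), ⟨C, hC, fun g hg => s g fun h => hg (by simp [h])⟩,
      fun h g => ?_⟩
    simp [e]

/-- The representation of `G` on `cInd_H^G σ` by right translation, `(g' • f) g = f (g * g')`. -/
def cInd [ContinuousMul G] : Representation k G (cIndSpace H σ) where
  toFun g' :=
    { toFun := fun f => ⟨fun g => f.1 (g * g'), by
        obtain ⟨f, l, ⟨C, hC, s⟩, e⟩ := f
        refine ⟨l.comp_continuous (continuous_mul_const g'),
          ⟨(fun x => x * g'⁻¹) '' C, hC.image (continuous_mul_const g'⁻¹), fun g hg => ?_⟩,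
          fun h g => ?_⟩
        · obtain ⟨h, hh, c, hc, hgc⟩ := s _ hg
          refine ⟨h, hh, c * g'⁻¹, ⟨c, hc, rfl⟩, ?_⟩
          rw [← mul_assoc, ← hgc, mul_inv_cancel_right]
        · show f (h * g * g') = σ h (f (g * g'))
          rw [mul_assoc, e]⟩
      map_add' := fun _ _ => rfl
      map_smul' := fun _ _ => rfl }
  map_one' := by
    ext f g
    simp
  map_mul' g₁ g₂ := by
    ext f g
    simp [mul_assoc]

open Classical in
/-- The function `[g, v] : G → V` with support in `H * g⁻¹` and with value `v` at `g⁻¹`, that is,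
`[g, v] (h * g⁻¹) = σ h v` for `h` in `H`. -/
def bracket (g : G) (v : V) : G → V :=
  fun x => if hx : x * g ∈ H then σ ⟨x * g, hx⟩ v else 0

/-- If `H` is open and `σ` is smooth, the functions `[g, v]` lie in `cInd_H^G σ`. -/
theorem bracket_mem [ContinuousMul G] (hH : IsOpen (H : Set G)) (hσ : IsSmooth σ) (g : G) (v : V) :
    bracket H σ g v ∈ cIndSpace H σ := by
  refine ⟨?_, ⟨{g⁻¹}, isCompact_singleton, fun x hx => ?_⟩, fun h x => ?_⟩
  · rw [IsLocallyConstant.iff_exists_open]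
    intro x
    obtain ⟨U, hU, hUv⟩ := hσ v
    refine ⟨(fun y => (x * g)⁻¹ * (y * g)) ⁻¹' (Subtype.val '' (U : Set H)),
      (hH.isOpenMap_subtype_val _ hU).preimage (by fun_prop), ⟨1, U.one_mem, by simp⟩, ?_⟩
    rintro y ⟨u, hu, hy⟩
    have hy' : y * g = x * g * u := by
      rw [show (u : G) = (x * g)⁻¹ * (y * g) from hy, mul_inv_cancel_left]
    by_cases hm : x * g ∈ H
    · have hm' : y * g ∈ H := hy' ▸ H.mul_mem hm u.2
      have : (⟨y * g, hm'⟩ : H) = ⟨x * g, hm⟩ * u := Subtype.ext hy'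
      simp [bracket, hm, hm', this, hUv u hu]
    · have hm' : y * g ∉ H := by
        rw [hy']; exact fun hc => hm ((H.mul_mem_cancel_right u.2).1 hc)
      simp [bracket, hm, hm']
  · by_cases hm : x * g ∈ H
    · exact ⟨x * g, hm, g⁻¹, rfl, by simp⟩
    · exact absurd (by simp [bracket, hm]) hx
  · by_cases hm : x * g ∈ H
    · have hm' : (h : G) * x * g ∈ H := by rw [mul_assoc]; exact H.mul_mem h.2 hm
      have : (⟨(h : G) * x * g, hm'⟩ : H) = h * ⟨x * g, hm⟩ := Subtype.ext (mul_assoc _ _ _)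
      simp [bracket, hm, hm', this]
    · have hm' : (h : G) * x * g ∉ H := by
        rw [mul_assoc]; exact fun hc => hm ((H.mul_mem_cancel_left h.2).1 hc)
      simp [bracket, hm, hm']

end General

section GL2

variable (F : Type*) [Field F] [ValuativeRel F]

/-- The maximal compact subgroup `K = GL₂(𝒪)` of `GL₂(F)`. -/
def K : Subgroup (GL (Fin 2) F) :=
  (Matrix.GeneralLinearGroup.map (n := Fin 2) (algebraMap 𝒪[F] F)).range

/-- The subgroup `KZ`, with `Z` the centre of `GL₂(F)`. -/
def KZ : Subgroup (GL (Fin 2) F) := K F ⊔ Subgroup.center (GL (Fin 2) F)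

/-- `P⁺`, the set of the matrices `(a b; 0 1)` with `a` in `𝒪 \ {0}` and `b` in `𝒪`. -/
def PPlus : Set (GL (Fin 2) F) :=
  {g : GL (Fin 2) F | ∃ a b : 𝒪[F], a ≠ 0 ∧ (g : Matrix (Fin 2) (Fin 2) F) = !![(a : F), (b : F); 0, 1]}

variable {F}

/-- The matrix `Π = (0 1; ϖ 0)` attached to a uniformizer `ϖ`. -/
def Pi (ϖ : 𝒪[F]) (hϖ : Irreducible ϖ) : GL (Fin 2) F :=
  Matrix.GeneralLinearGroup.mkOfDetNeZero !![0, 1; (ϖ : F), 0] (by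
    simpa [Matrix.det_fin_two] using hϖ.ne_zero)

variable [TopologicalSpace F] {k V W : Type*} [Field k]
  [AddCommGroup V] [Module k V] [AddCommGroup W] [Module k W]

/-- A weight: a smooth irreducible representation of `KZ`. -/
structure IsWeight (σ : Representation k (KZ F) V) : Prop where
  smooth : IsSmooth σ
  irreducible : σ.IsIrreducible

/-- The subgroup `KZ` is open, so that the functions `[g, v]` lie in `cInd_{KZ}^G σ` for every
weight `σ`. -/
theorem isOpen_KZ [IsNonarchimedeanLocalField F] : IsOpen (KZ F : Set (GL (Fin 2) F)) := by
  have hO : IsOpen {x : F | x ∈ 𝒪[F]} := by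
    let := IsTopologicalAddGroup.rightUniformSpace F
    have := isUniformAddGroup_of_addCommGroup (G := F)
    exact Valued.isOpen_integer F
  have hK : IsOpen (K F : Set (GL (Fin 2) F)) := by
    have hset : (K F : Set (GL (Fin 2) F)) =
        {g : GL (Fin 2) F | ∀ i j, (g : Matrix (Fin 2) (Fin 2) F) i j ∈ 𝒪[F] ∧
          ((g⁻¹ : GL (Fin 2) F) : Matrix (Fin 2) (Fin 2) F) i j ∈ 𝒪[F]} := by
      ext g
      constructor
      · rintro ⟨x, rfl⟩ i j
        rw [← map_inv]
        exact ⟨(x i j).2, ((x⁻¹ : GL (Fin 2) 𝒪[F]) i j).2⟩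
      · intro h
        have hinj : Function.Injective ((algebraMap 𝒪[F] F).mapMatrix (m := Fin 2)) :=
          Matrix.map_injective Subtype.val_injective
        let A : Matrix (Fin 2) (Fin 2) 𝒪[F] := Matrix.of fun i j => ⟨_, (h i j).1⟩
        let B : Matrix (Fin 2) (Fin 2) 𝒪[F] := Matrix.of fun i j => ⟨_, (h i j).2⟩
        have hA : (algebraMap 𝒪[F] F).mapMatrix A = g.val := rfl
        have hB : (algebraMap 𝒪[F] F).mapMatrix B = g⁻¹.val := rfl
        refine ⟨⟨A, B, hinj ?_, hinj ?_⟩, Units.ext rfl⟩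
        · rw [map_mul, map_one, hA, hB, Units.mul_inv]
        · rw [map_mul, map_one, hA, hB, Units.inv_mul]
    rw [hset]
    simp only [Set.ofPred_forall, Set.ofPred_and]
    refine isOpen_iInter_of_finite fun i => isOpen_iInter_of_finite fun j => IsOpen.inter ?_ ?_
    · exact hO.preimage ((Units.continuous_val.matrix_elem i j))
    · exact hO.preimage (((Units.continuous_val.comp continuous_inv).matrix_elem i j))
  exact Subgroup.isOpen_mono (le_sup_left : K F ≤ KZ F) hK

variable [IsNonarchimedeanLocalField F] (ϖ : 𝒪[F]) (hϖ : Irreducible ϖ)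
  (σ : Representation k (KZ F) V)

/-- `I⁺(σ)`, the subspace of `cInd_{KZ}^G σ` spanned by the `[g, v]` with `g` in `P⁺`
and `v` in `σ`. -/
def IPlus : Submodule k (cIndSpace (KZ F) σ) :=
  Submodule.span k {f | ∃ g ∈ PPlus F, ∃ v : V, (f : GL (Fin 2) F → V) = bracket (KZ F) σ g v}

/-- `I⁻(σ) = Π · I⁺(σ)`. -/
def IMinus : Submodule k (cIndSpace (KZ F) σ) :=
  (IPlus σ).map (cInd (KZ F) σ (Pi ϖ hϖ))

variable {σ} {π : Representation k (GL (Fin 2) F) W}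
  (φ : Representation.IntertwiningMap (cInd (KZ F) σ) π)

/-- `D₁(σ, π)`, the intersection of the images `I⁺(σ, π)` and `I⁻(σ, π)` in `π` of `I⁺(σ)`
and `I⁻(σ)`. -/
def D1 : Submodule k W :=
  (IPlus σ).map φ.toLinearMap ⊓ (IMinus ϖ hϖ σ).map φ.toLinearMap

/-- `R(σ, π)`, the kernel of `cInd_{KZ}^G σ → π`, as a `k[G]`-module. -/
def R : Submodule k[GL (Fin 2) F] (cInd (KZ F) σ).asModule :=
  φ.ker.asSubmodule

end GL2

end ModpGL2

end

/-! The cosets `g KZ` are the vertices of the Bruhat–Tits tree, and an element of the compact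
induction is a finitely supported family of vectors on these vertices. Removing the edge from `KZ`
to `Π KZ` leaves two half-trees, and `I⁺(σ)`, `I⁻(σ)` are exactly the functions supported on them
(`IPlus_eq_supportedOn`, `IsHalfTree.map_supportedOn`). Each relation `f` in `R` therefore splits
uniquely as `f₁ + f₂` at this edge, and `f ↦ φ f₁` identifies `D₁` with `R / ((R ∩ I⁺) ⊕ (R ∩ I⁻))`:
`D₁` measures the failure of relations to split at an edge.

If `D₁` is finite-dimensional, it lifts to functions of `I⁻` supported in one fixed ball. So at any
edge, the part of a relation on one side has the same image as some function close to the edge on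
the other side, and the difference of the two is a relation. Cutting off branches in this way
reduces every relation to translates of relations supported in the fixed ball; these form a
finite-dimensional space, which thus generates `R`
(`IsHalfTree.fg_ker_asSubmodule_of_finiteDimensional`).

If `R` is finitely generated, the generators live in a ball of radius `m`. A translate of a
generator either lies on one side of the base edge or is supported in a fixed larger ball. Hence, up
to relations that split, only functions on that ball contribute to `D₁`
(`IsHalfTree.finiteDimensional_edgeSpace_of_fg`).

Both arguments use only the axioms `IsHalfTree`, checked in `isHalfTree` by comparing the lengths of
the two rows of a matrix, together with finiteness of the residue field and of the dimension of a
weight (`IsWeight.finiteDimensional`). -/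

noncomputable section

namespace ModpGL2

/-! ### Unions of cosets -/

section Cosets

variable {G : Type*} [Group G]

/-- A set of elements of `G` that is a union of left cosets of `H`. -/
def IsRightStable (H : Subgroup G) (T : Set G) : Prop :=
  ∀ ⦃g⦄, g ∈ T → ∀ h ∈ H, g * h ∈ T

theorem IsRightStable.mul_mem_iff {H : Subgroup G} {T : Set G} (hT : IsRightStable H T)
    {g h : G} (hh : h ∈ H) :
    g * h ∈ T ↔ g ∈ T :=
  ⟨fun hg => by simpa using hT hg h⁻¹ (H.inv_mem hh), fun hg => hT hg h hh⟩

/-- A set covered by finitely many left cosets of `H`. -/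
def FinCosets (H : Subgroup G) (T : Set G) : Prop :=
  ∃ s : Finset G, ∀ g ∈ T, ∃ t ∈ s, t⁻¹ * g ∈ H

end Cosets

/-! ### Functions in the compact induction with prescribed support -/

section Supports

variable {k G V : Type*} [Field k] [Group G] [TopologicalSpace G] [ContinuousMul G]
  [AddCommGroup V] [Module k V] {H : Subgroup G} {σ : Representation k H V}

variable (σ) in
/-- The functions in `cInd_H^G σ` that vanish at `g⁻¹` for all `g` outside of `T`. -/
def supportedOn (T : Set G) : Submodule k (cIndSpace H σ) where
  carrier := {f | ∀ g, f.1 g ≠ 0 → g⁻¹ ∈ T}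
  zero_mem' := fun _ hg => absurd rfl hg
  add_mem' := by
    intro f₁ f₂ h₁ h₂ g hg
    by_cases h : f₁.1 g = 0
    · exact h₂ g fun h' => hg (by simp [h, h'])
    · exact h₁ g h
  smul_mem' := by
    intro a f hf g hg
    exact hf g fun h => hg (by simp [h])

theorem supportedOn_mono {T₁ T₂ : Set G} (h : T₁ ⊆ T₂) : supportedOn σ T₁ ≤ supportedOn σ T₂ :=
  fun _ hf g hg => h (hf g hg)

theorem cInd_mem_supportedOn {T : Set G} {f : cIndSpace H σ} (g : G) :
    cInd H σ g f ∈ supportedOn σ T ↔ f ∈ supportedOn σ {x | g * x ∈ T} := by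
  constructor
  · intro hf x hx
    have := hf (x * g⁻¹) (by simpa [cInd] using hx)
    simpa using this
  · intro hf x hx
    have := hf (x * g) hx
    simpa using this

open Classical in
/-- The restriction of a function in `cInd_H^G σ` to a union of cosets. -/
def restrict (hH : IsOpen (H : Set G)) {T : Set G} (hT : IsRightStable H T) :
    cIndSpace H σ →ₗ[k] cIndSpace H σ where
  toFun f := ⟨fun g => if g⁻¹ ∈ T then f.1 g else 0, by
    obtain ⟨f, l, ⟨C, hC, s⟩, e⟩ := f
    have key : ∀ h ∈ H, ∀ g, (h * g)⁻¹ ∈ T ↔ g⁻¹ ∈ T := fun h hh g => by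
      rw [mul_inv_rev]; exact hT.mul_mem_iff (H.inv_mem hh)
    refine ⟨?_, ⟨C, hC, fun g hg => s g fun h => hg (by simp [h])⟩, fun h g => ?_⟩
    · rw [IsLocallyConstant.iff_exists_open] at l ⊢
      intro x
      obtain ⟨U, hU, hx, hUf⟩ := l x
      refine ⟨U ∩ (fun y => y * x⁻¹) ⁻¹' H,
        hU.inter (hH.preimage (continuous_mul_const x⁻¹)), ⟨hx, by simp⟩, ?_⟩
      rintro y ⟨hy, hyH⟩
      have := key _ hyH x
      rw [inv_mul_cancel_right] at this
      simp only [this, hUf y hy]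
    · show (if ((h : G) * g)⁻¹ ∈ T then f (h * g) else 0) = σ h (if g⁻¹ ∈ T then f g else 0)
      simp only [key h h.2 g, e]
      split_ifs <;> simp⟩
  map_add' f₁ f₂ := by
    ext g
    by_cases h : g⁻¹ ∈ T <;> simp [h]
  map_smul' a f := by
    ext g
    by_cases h : g⁻¹ ∈ T <;> simp [h]

theorem restrict_apply_of_mem (hH : IsOpen (H : Set G)) {T : Set G} (hT : IsRightStable H T)
    (f : cIndSpace H σ) {g : G} (hg : g⁻¹ ∈ T) : (restrict hH hT f).1 g = f.1 g := by
  simp [restrict, hg]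

theorem restrict_apply_of_notMem (hH : IsOpen (H : Set G)) {T : Set G} (hT : IsRightStable H T)
    (f : cIndSpace H σ) {g : G} (hg : g⁻¹ ∉ T) : (restrict hH hT f).1 g = 0 := by
  simp [restrict, hg]

theorem restrict_mem (hH : IsOpen (H : Set G)) {T T' : Set G} (hT : IsRightStable H T)
    {f : cIndSpace H σ} (hf : f ∈ supportedOn σ T') :
    restrict hH hT f ∈ supportedOn σ (T ∩ T') := by
  intro g hg
  by_cases h : g⁻¹ ∈ T
  · rw [restrict_apply_of_mem hH hT f h] at hg
    exact ⟨h, hf g hg⟩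
  · exact absurd (restrict_apply_of_notMem hH hT f h) hg

theorem sub_restrict_mem (hH : IsOpen (H : Set G)) {T T' : Set G} (hT : IsRightStable H T)
    {f : cIndSpace H σ} (hf : f ∈ supportedOn σ T') :
    f - restrict hH hT f ∈ supportedOn σ (T' \ T) := by
  intro g hg
  by_cases h : g⁻¹ ∈ T
  · exact absurd (by simp [restrict_apply_of_mem hH hT f h]) hg
  · refine ⟨hf g fun h' => hg ?_, h⟩
    simp [restrict_apply_of_notMem hH hT f h, h']

theorem mem_supportedOn_univ (f : cIndSpace H σ) : f ∈ supportedOn σ Set.univ :=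
  fun _ _ => trivial

theorem eq_zero_of_mem_supportedOn {T T' : Set G} {f : cIndSpace H σ} (h : f ∈ supportedOn σ T)
    (h' : f ∈ supportedOn σ T') (hTT : Disjoint T T') : f = 0 := by
  ext g
  by_contra hg
  exact Set.disjoint_left.1 hTT (h g hg) (h' g hg)

theorem exists_finCosets (hH : IsOpen (H : Set G)) (f : cIndSpace H σ) :
    ∃ s : Finset G, f ∈ supportedOn σ {g | ∃ t ∈ s, t⁻¹ * g ∈ H} := by
  classical
  obtain ⟨f, l, ⟨C, hC, s⟩, e⟩ := f
  obtain ⟨t, ht⟩ := hC.elim_finite_subcover (fun x : G => (fun y => y * x⁻¹) ⁻¹' (H : Set G))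
    (fun x => hH.preimage (continuous_mul_const _))
    (fun x _ => Set.mem_iUnion.2 ⟨x, by simp⟩)
  -- The support is covered by right cosets `H x`; supports are indexed by inverses, which turns
  -- these into the left cosets of the `x⁻¹`.
  refine ⟨t.image (·⁻¹), fun g hg => ?_⟩
  obtain ⟨h, hh, c, hc, rfl⟩ := s g hg
  obtain ⟨x, hx, hcx⟩ : ∃ x ∈ t, c * x⁻¹ ∈ H := by simpa using ht hc
  refine ⟨x⁻¹, Finset.mem_image_of_mem _ hx, ?_⟩
  have := H.inv_mem (H.mul_mem hh hcx)
  simpa [mul_assoc] using this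

/-- By equivariance, evaluation at the inverses of finitely many coset representatives is injective.
-/
theorem finiteDimensional_supportedOn [FiniteDimensional k V] {T : Set G} (hT : FinCosets H T) :
    FiniteDimensional k (supportedOn σ T) := by
  obtain ⟨s, hs⟩ := hT
  let ev : supportedOn σ T →ₗ[k] (s → V) :=
    { toFun := fun f t => f.1.1 (t : G)⁻¹
      map_add' := fun _ _ => rfl
      map_smul' := fun _ _ => rfl }
  refine Module.Finite.of_injective ev fun f₁ f₂ h₁₂ => ?_
  rw [← sub_eq_zero]
  set f := f₁ - f₂
  have hf : ev f = 0 := sub_eq_zero.2 h₁₂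
  ext g
  by_contra hg
  obtain ⟨t, ht, hh⟩ := hs _ (f.2 g hg)
  have h0 : f.1.1 t⁻¹ = 0 := congrFun hf ⟨t, ht⟩
  have := f.1.2.2.2 ⟨_, H.inv_mem hh⟩ t⁻¹
  rw [h0, map_zero] at this
  exact hg (by simpa using this)

theorem supportedOn_le_span (hH : IsOpen (H : Set G)) {T : Set G} (hT : IsRightStable H T) :
    supportedOn σ T ≤ Submodule.span k
      {f : cIndSpace H σ | ∃ g ∈ T, ∃ v : V, (f : G → V) = bracket H σ g v} := by
  classical
  intro f hf
  obtain ⟨s, hs⟩ := exists_finCosets hH f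
  induction s using Finset.induction_on generalizing f with
  | empty =>
    have : f = 0 := by
      ext g
      by_contra hg
      simpa using hs g hg
    rw [this]
    exact Submodule.zero_mem _
  | insert t s hts ih =>
    have hC : IsRightStable H {g | t⁻¹ * g ∈ H} := fun g hg h hh => by
      show t⁻¹ * (g * h) ∈ H
      rw [← mul_assoc]
      exact H.mul_mem hg hh
    have hsub := ih (f := f - restrict hH hC f)
      (supportedOn_mono Set.sdiff_subset (sub_restrict_mem hH hC hf))
      (supportedOn_mono (fun g hg => by
        obtain ⟨⟨u, hu, hug⟩, hg⟩ := hg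
        rcases Finset.mem_insert.1 hu with rfl | hu
        · exact absurd hug hg
        · exact ⟨u, hu, hug⟩) (sub_restrict_mem hH hC hs))
    rw [← sub_add_cancel f (restrict hH hC f)]
    refine Submodule.add_mem _ hsub ?_
    by_cases ht : t ∈ T
    · refine Submodule.subset_span ⟨t, ht, f.1 t⁻¹, ?_⟩
      ext x
      by_cases hx : x * t ∈ H
      · have hx' : t⁻¹ * x⁻¹ ∈ H := by simpa using H.inv_mem hx
        rw [restrict_apply_of_mem hH hC f (g := x) hx']
        have := f.2.2.2 ⟨_, hx⟩ t⁻¹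
        simpa [bracket, hx] using this
      · have hx' : ¬ t⁻¹ * x⁻¹ ∈ H := fun h => hx (by simpa using H.inv_mem h)
        rw [restrict_apply_of_notMem hH hC f (g := x) hx']
        simp [bracket, hx]
    · have : restrict hH hC f = 0 := by
        ext x
        by_contra hx
        obtain ⟨h₁, h₂⟩ := restrict_mem hH hC hf x hx
        exact ht (by simpa using hT h₂ _ (H.inv_mem h₁))
      rw [this]
      exact Submodule.zero_mem _

/-- Since `[t h, v] = [t, h v]` for `h` in `H`, one representative per coset is enough. This applies
to `P⁺` inside the half-tree. -/
theorem span_bracket_eq_supportedOn (hH : IsOpen (H : Set G)) {T T' : Set G}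
    (hT : IsRightStable H T) (hTT : T' ⊆ T) (hcover : ∀ g ∈ T, ∃ t ∈ T', t⁻¹ * g ∈ H) :
    Submodule.span k {f : cIndSpace H σ | ∃ g ∈ T', ∃ v : V, (f : G → V) = bracket H σ g v} =
      supportedOn σ T := by
  apply le_antisymm
  · refine Submodule.span_le.2 ?_
    rintro f ⟨g, hg, v, hf⟩ x hx
    have hxg : x * g ∈ H := by
      by_contra h
      exact hx (by rw [hf]; simp [bracket, h])
    simpa using hT (hTT hg) _ (H.inv_mem hxg)
  · refine (supportedOn_le_span hH hT).trans (Submodule.span_mono ?_)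
    rintro f ⟨g, hg, v, hf⟩
    obtain ⟨t, ht, hh⟩ := hcover g hg
    refine ⟨t, ht, σ ⟨_, hh⟩ v, ?_⟩
    rw [hf]
    ext x
    have : x * g = x * t * (t⁻¹ * g) := by group
    by_cases hx : x * t ∈ H
    · have hx' : x * g ∈ H := this ▸ H.mul_mem hx hh
      have : (⟨x * g, hx'⟩ : H) = ⟨x * t, hx⟩ * ⟨_, hh⟩ := Subtype.ext this
      simp only [bracket, dif_pos hx, dif_pos hx']
      rw [this, map_mul]
      rfl
    · have hx' : ¬ x * g ∈ H := by rw [this, H.mul_mem_cancel_right hh]; exact hx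
      simp [bracket, hx, hx']

end Supports

/-! ### Axioms for a half-tree and finiteness of balls -/

section Cosets

variable {G : Type*} [Group G]

/-- A half-tree datum. The cosets `gH` play the role of the vertices of a tree, `S n` that of the
ball of radius `n` around `H`, and `P` that of one of the two half-trees that are left when one
removes the edge from `H` to `wH`. The group element `w` exchanges the two half-trees, and `P` is
the disjoint union of its root `H` and of its translates by the `c i`. -/
structure IsHalfTree {ι : Type*} (H : Subgroup G) (w : G) (c : ι → G) (P : Set G)
    (S : ℕ → Set G) : Prop where
  ball_zero : S 0 = H
  ball_mono : Monotone S
  mul_mem_ball : ∀ {m n g x}, g ∈ S m → x ∈ S n → g * x ∈ S (m + n)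
  exists_mem_ball : ∀ g, ∃ n, g ∈ S n
  rightStable : IsRightStable H P
  inv_mul_mem_iff : ∀ x, w⁻¹ * x ∈ P ↔ x ∉ P
  inv_mul_mem_ball : ∀ {n x}, x ∈ S n → x ∉ P → w⁻¹ * x ∈ S n
  branch_mul_mem : ∀ i, c i * w ∈ H
  branch_disjoint : ∀ {i j x}, (c i)⁻¹ * x ∈ P → (c j)⁻¹ * x ∈ P → i = j
  branch_cover : ∀ {x}, x ∈ P → x ∈ H ∨ ∃ i, (c i)⁻¹ * x ∈ P
  branch_depth : ∀ {i n x}, (c i)⁻¹ * x ∈ P → x ∈ S (n + 1) → (c i)⁻¹ * x ∈ S n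
  translate_ball : ∀ {m g}, g ∉ S (m + 1) → (∀ x ∈ S m, g * x ∈ P) ∨ (∀ x ∈ S m, g * x ∉ P)

namespace IsHalfTree

variable {ι : Type*} {H : Subgroup G} {w : G} {c : ι → G} {P : Set G} {S : ℕ → Set G}

theorem ball_rightStable (hS : IsHalfTree H w c P S) (n : ℕ) : IsRightStable H (S n) := by
  intro g hg h hh
  have h0 : h ∈ S 0 := by rw [hS.ball_zero]; exact hh
  exact hS.mul_mem_ball hg h0

theorem mul_mem_ball_of_mem (hS : IsHalfTree H w c P S) {n : ℕ} {h x : G} (hh : h ∈ H)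
    (hx : x ∈ S n) : h * x ∈ S n := by
  have h0 : h ∈ S 0 := by rw [hS.ball_zero]; exact hh
  simpa using hS.mul_mem_ball h0 hx

theorem branch_rightStable (hS : IsHalfTree H w c P S) (i : ι) :
    IsRightStable H {x | (c i)⁻¹ * x ∈ P} := fun x hx h hh => by
  show (c i)⁻¹ * (x * h) ∈ P
  rw [← mul_assoc]
  exact hS.rightStable hx h hh

theorem finCosets_ball_inter [Finite ι] (hS : IsHalfTree H w c P S) (n : ℕ) :
    FinCosets H (S n ∩ P) := by
  classical
  have := Fintype.ofFinite ι
  induction n with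
  | zero =>
    refine ⟨{1}, fun g hg => ⟨1, Finset.mem_singleton_self _, ?_⟩⟩
    have : g ∈ (H : Set G) := hS.ball_zero ▸ hg.1
    simpa using this
  | succ n ih =>
    obtain ⟨s, hs⟩ := ih
    refine ⟨{1} ∪ (Finset.univ ×ˢ s).image (fun x : ι × G => c x.1 * x.2), fun g hg => ?_⟩
    rcases hS.branch_cover hg.2 with h | ⟨i, hi⟩
    · exact ⟨1, by simp, by simpa using h⟩
    · obtain ⟨t, ht, htg⟩ := hs _ ⟨hS.branch_depth hi hg.1, hi⟩
      refine ⟨c i * t,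
        Finset.mem_union_right _ (Finset.mem_image.2 ⟨(i, t), by simp [ht], rfl⟩), ?_⟩
      rwa [mul_inv_rev, mul_assoc]

theorem finCosets_ball [Finite ι] (hS : IsHalfTree H w c P S) (n : ℕ) : FinCosets H (S n) := by
  classical
  obtain ⟨s, hs⟩ := hS.finCosets_ball_inter n
  refine ⟨s ∪ s.image (w * ·), fun g hg => ?_⟩
  by_cases hP : g ∈ P
  · obtain ⟨t, ht, h⟩ := hs g ⟨hg, hP⟩
    exact ⟨t, Finset.mem_union_left _ ht, h⟩
  · obtain ⟨t, ht, h⟩ := hs _ ⟨hS.inv_mul_mem_ball hg hP, (hS.inv_mul_mem_iff g).2 hP⟩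
    refine ⟨w * t, Finset.mem_union_right _ (Finset.mem_image_of_mem _ ht), ?_⟩
    rwa [mul_inv_rev, mul_assoc]

end IsHalfTree

end Cosets

/-! ### The equivalence for a half-tree -/

section Quotients

variable {k G V W ι : Type*} [Field k] [Group G] [TopologicalSpace G] [ContinuousMul G]
  [AddCommGroup V] [Module k V] [AddCommGroup W] [Module k W]
  {H : Subgroup G} {σ : Representation k H V} {π : Representation k G W}
  {w : G} {c : ι → G} {P : Set G} {S : ℕ → Set G}

/-- The intersection of the images in `π` of the functions supported on the two half-trees. -/
def edgeSpace (σ : Representation k H V) (P : Set G)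
    (φ : Representation.IntertwiningMap (cInd H σ) π) : Submodule k W :=
  (supportedOn σ P).map φ.toLinearMap ⊓ (supportedOn σ Pᶜ).map φ.toLinearMap

namespace IsHalfTree

theorem exists_mem_supportedOn_ball (hS : IsHalfTree H w c P S) (hH : IsOpen (H : Set G))
    (f : cIndSpace H σ) : ∃ n, f ∈ supportedOn σ (S n) := by
  obtain ⟨s, hs⟩ := exists_finCosets hH f
  choose N hN using hS.exists_mem_ball
  refine ⟨s.sup N, fun g hg => ?_⟩
  obtain ⟨t, ht, hh⟩ := hs g hg
  have := hS.ball_rightStable _ (hS.ball_mono (Finset.le_sup ht) (hN t)) _ hh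
  simpa using this

theorem exists_forall_mem_supportedOn_ball (hS : IsHalfTree H w c P S) (hH : IsOpen (H : Set G))
    {α : Type*} (s : Finset α) (f : α → cIndSpace H σ) :
    ∃ n, ∀ a ∈ s, f a ∈ supportedOn σ (S n) := by
  choose N hN using hS.exists_mem_supportedOn_ball (σ := σ) hH
  exact ⟨s.sup (N ∘ f), fun a ha =>
    supportedOn_mono (hS.ball_mono (Finset.le_sup (f := N ∘ f) ha)) (hN (f a))⟩

theorem map_supportedOn (hS : IsHalfTree H w c P S) :
    (supportedOn σ P).map (cInd H σ w) = supportedOn σ Pᶜ := by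
  ext f
  have key : f ∈ supportedOn σ Pᶜ ↔ cInd H σ w⁻¹ f ∈ supportedOn σ P := by
    rw [cInd_mem_supportedOn]
    have : {x | w⁻¹ * x ∈ P} = Pᶜ := Set.ext hS.inv_mul_mem_iff
    rw [this]
  rw [key]
  constructor
  · rintro ⟨f, hf, rfl⟩
    rwa [Representation.inv_self_apply]
  · intro hf
    exact ⟨_, hf, Representation.self_inv_apply _ _ _⟩

variable (φ : Representation.IntertwiningMap (cInd H σ) π)

theorem fg_ker_asSubmodule_of_finiteDimensional [Finite ι] [FiniteDimensional k V]
    (hS : IsHalfTree H w c P S)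
    (hH : IsOpen (H : Set G)) (hfin : FiniteDimensional k (edgeSpace σ P φ)) :
    φ.ker.asSubmodule.FG := by
  classical
  have := Fintype.ofFinite ι
  -- every element of the edge space lifts to a function on the opposite half of a fixed ball
  obtain ⟨N, hN⟩ : ∃ N, ∀ x ∈ edgeSpace σ P φ, ∃ f ∈ supportedOn σ (S N ∩ Pᶜ), φ f = x := by
    obtain ⟨s, hs⟩ := (Submodule.fg_iff_finiteDimensional _).2 hfin
    have hlift : ∀ x : s, ∃ f ∈ supportedOn σ Pᶜ, φ f = x := fun x =>
      ((hs ▸ Submodule.subset_span x.2 : (x : W) ∈ edgeSpace σ P φ)).2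
    choose F hF hFx using hlift
    obtain ⟨N, hN⟩ := hS.exists_forall_mem_supportedOn_ball hH Finset.univ F
    refine ⟨N, fun x hx => ?_⟩
    have hle : edgeSpace σ P φ ≤ (supportedOn σ (S N ∩ Pᶜ)).map φ.toLinearMap := by
      rw [← hs]
      refine Submodule.span_le.2 fun x hx => ⟨F ⟨x, hx⟩, fun g hg => ?_, hFx ⟨x, hx⟩⟩
      exact ⟨hN _ (Finset.mem_univ _) g hg, hF _ g hg⟩
    exact hle hx
  -- Cutting at the edge from `gH` to `gwH`: in a relation `f₁ + f₂` one has `φ f₁ = -φ f₂`, so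
  -- after translation by `g⁻¹` this vector lies in the edge space and has a lift near the edge, on
  -- the side opposite to `f₁`.
  have hNg : ∀ (g : G) (f₁ f₂ : cIndSpace H σ), f₁ ∈ supportedOn σ {x | g⁻¹ * x ∈ P} →
      f₂ ∈ supportedOn σ {x | g⁻¹ * x ∈ Pᶜ} → φ (f₁ + f₂) = 0 →
      ∃ f, cInd H σ g⁻¹ f ∈ supportedOn σ (S N ∩ Pᶜ) ∧ φ f = φ f₁ := by
    intro g f₁ f₂ h₁ h₂ h
    have h₁' := (cInd_mem_supportedOn g⁻¹).2 h₁
    have h₂' := (cInd_mem_supportedOn g⁻¹).2 h₂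
    obtain ⟨f, hf, hφ⟩ := hN (φ (cInd H σ g⁻¹ f₁)) ⟨⟨_, h₁', rfl⟩, ⟨_, neg_mem h₂', by
      have h0 : φ f₁ = - φ f₂ := eq_neg_of_add_eq_zero_left (by rw [← map_add]; exact h)
      show φ (- _) = _
      rw [map_neg, φ.isIntertwining, φ.isIntertwining, h0, map_neg]⟩⟩
    refine ⟨cInd H σ g f, by rwa [Representation.inv_self_apply], ?_⟩
    rw [φ.isIntertwining, hφ, ← φ.isIntertwining, Representation.self_inv_apply]
  have hLfin : FiniteDimensional k ↥(φ.ker.toSubmodule ⊓ supportedOn σ (S N)) :=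
    have := finiteDimensional_supportedOn (σ := σ) (hS.finCosets_ball N)
    Submodule.finiteDimensional_of_le inf_le_right
  obtain ⟨s, hs⟩ := (Submodule.fg_iff_finiteDimensional _).2 hLfin
  let M₀ : Submodule k[G] (cInd H σ).asModule :=
    Submodule.span k[G] (s : Set (cIndSpace H σ))
  let M : Subrepresentation (cInd H σ) := Subrepresentation.ofSubmodule' M₀
  have hsM : ∀ f ∈ s, f ∈ M.toSubmodule := fun f hf =>
    Submodule.subset_span (R := k[G]) (M := (cInd H σ).asModule) hf
  have hball : ∀ f, φ f = 0 → f ∈ supportedOn σ (S N) → f ∈ M.toSubmodule := fun f h₁ h₂ => by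
    have hf : f ∈ φ.ker.toSubmodule ⊓ supportedOn σ (S N) := ⟨h₁, h₂⟩
    rw [← hs] at hf
    exact Submodule.span_le.2 hsM hf
  have hstable : ∀ g f, cInd H σ g⁻¹ f ∈ M.toSubmodule → f ∈ M.toSubmodule := fun g f hf => by
    have := M.apply_mem_toSubmodule g hf
    rwa [Representation.self_inv_apply] at this
  -- prune the branches of the half-tree `P` one level at a time
  have hprune : ∀ n f, φ f = 0 → f ∈ supportedOn σ (S n ∩ P ∪ S N) → f ∈ M.toSubmodule := by
    intro n
    induction n with
    | zero =>
      intro f h₁ h₂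
      refine hball f h₁ (supportedOn_mono ?_ h₂)
      exact Set.union_subset (Set.inter_subset_left.trans (hS.ball_mono (Nat.zero_le N))) le_rfl
    | succ n ih =>
      intro f h₁ h₂
      let r : ι → cIndSpace H σ := fun i => restrict hH (hS.branch_rightStable i) f
      have hr : ∀ i, r i ∈ supportedOn σ ({x | (c i)⁻¹ * x ∈ P} ∩ (S (n + 1) ∩ P ∪ S N)) :=
        fun i => restrict_mem hH _ h₂
      have hex : ∀ i, ∃ h, cInd H σ (c i)⁻¹ h ∈ supportedOn σ (S N ∩ Pᶜ) ∧ φ h = φ (r i) :=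
        fun i => hNg (c i) (r i) (f - r i) (supportedOn_mono Set.inter_subset_left (hr i))
          (supportedOn_mono (fun x hx => hx.2)
            (sub_restrict_mem hH (hS.branch_rightStable i) (mem_supportedOn_univ f)))
          (by rw [add_sub_cancel]; exact h₁)
      choose h hh hφh using hex
      have hrh : ∀ i, r i - h i ∈ M.toSubmodule := fun i => by
        refine hstable (c i) _ (ih _ ?_ ?_)
        · rw [φ.isIntertwining, map_sub, hφh, sub_self, map_zero]
        · rw [map_sub]
          refine sub_mem ?_ (supportedOn_mono (Set.inter_subset_left.trans Set.subset_union_right)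
            (hh i))
          rw [cInd_mem_supportedOn]
          refine supportedOn_mono ?_ (hr i)
          rintro x ⟨hx, ⟨hxn, -⟩ | hxN⟩
          · exact Or.inl ⟨hS.branch_depth hx hxn, hx⟩
          · exact Or.inr (hS.branch_depth hx (hS.ball_mono (Nat.le_succ N) hxN))
      -- Without its branches, `f` lives on the root and inside `S N`; the corrections `h i` stay
      -- inside `S N` as well.
      have hrest : f - ∑ i, (r i - h i) ∈ M.toSubmodule := by
        refine hball _ ?_ ?_
        · rw [map_sub, map_sum, h₁]
          simp [hφh]
        · rw [Finset.sum_sub_distrib, ← sub_add]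
          refine add_mem ?_ (sum_mem fun i _ => ?_)
          · intro g hg
            have hval : (f - ∑ i, r i).1 g = f.1 g - ∑ i, (r i).1 g := by
              simp [Finset.sum_apply]
            rw [hval] at hg
            by_cases hex : ∃ i, (c i)⁻¹ * g⁻¹ ∈ P
            · obtain ⟨i, hi⟩ := hex
              rw [Finset.sum_eq_single i, restrict_apply_of_mem hH (hS.branch_rightStable i) f hi,
                sub_self] at hg
              · exact absurd rfl hg
              · intro j _ hj
                exact restrict_apply_of_notMem hH (hS.branch_rightStable j) f
                  fun hj' => hj (hS.branch_disjoint hj' hi)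
              · exact fun hi => absurd (Finset.mem_univ i) hi
            · rw [Finset.sum_eq_zero, sub_zero] at hg
              · rcases h₂ g hg with ⟨-, hP⟩ | hN
                · have hgH : g⁻¹ ∈ S 0 := by
                    rw [hS.ball_zero]
                    exact (hS.branch_cover hP).resolve_right hex
                  exact hS.ball_mono (Nat.zero_le N) hgH
                · exact hN
              · intro i _
                exact restrict_apply_of_notMem hH (hS.branch_rightStable i) f
                  fun hi => hex ⟨i, hi⟩
          -- Write `x = (c i * w) * (w⁻¹ * (c i)⁻¹ * x)`: on the far side of the edge `w⁻¹` does not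
          -- increase the radius, and `c i * w` is in `H`. So the radius `N` does not grow during
          -- the induction.
          · refine supportedOn_mono ?_ ((cInd_mem_supportedOn _).1 (hh i))
            rintro x ⟨hxN, hxP⟩
            have := hS.mul_mem_ball_of_mem (hS.branch_mul_mem i) (hS.inv_mul_mem_ball hxN hxP)
            simpa [mul_assoc] using this
      rw [← sub_add_cancel f (∑ i, (r i - h i))]
      exact add_mem hrest (sum_mem fun i _ => hrh i)
  have hker : ∀ f, φ f = 0 → f ∈ M.toSubmodule := by
    intro f hf
    obtain ⟨n, hn⟩ := hS.exists_mem_supportedOn_ball hH f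
    let r := restrict hH hS.rightStable f
    have hr : r ∈ supportedOn σ (P ∩ S n) := restrict_mem hH _ hn
    have hfr : f - r ∈ supportedOn σ (S n \ P) := sub_restrict_mem hH _ hn
    -- A cut at the base edge writes `f` as a relation on `P` and `S N`, plus a relation supported
    -- off `P`, which `w⁻¹` carries into `P`.
    obtain ⟨h, hh, hφh⟩ := hNg 1 r (f - r)
      (by simpa using supportedOn_mono Set.inter_subset_left hr)
      (supportedOn_mono (fun x hx => by simpa using hx.2) hfr)
      (by rw [add_sub_cancel]; exact hf)
    rw [inv_one, map_one] at hh
    change h ∈ _ at hh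
    have h₁ : r - h ∈ M.toSubmodule := by
      refine hprune n _ (by rw [map_sub, hφh, sub_self]) (sub_mem ?_ ?_)
      · exact supportedOn_mono (fun x hx => Or.inl ⟨hx.2, hx.1⟩) hr
      · exact supportedOn_mono (fun x hx => Or.inr hx.1) hh
    have h₂ : f - (r - h) ∈ M.toSubmodule := by
      obtain ⟨n', hn'⟩ := hS.exists_mem_supportedOn_ball hH (cInd H σ w⁻¹ (f - (r - h)))
      refine hstable w _ (hprune n' _ ?_ ?_)
      · have h0 : φ (f - (r - h)) = 0 := by
          rw [map_sub, map_sub, hφh, hf, sub_self, sub_zero]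
        rw [φ.isIntertwining, h0, map_zero]
      · have : cInd H σ w⁻¹ (f - (r - h)) ∈ supportedOn σ P := by
          rw [cInd_mem_supportedOn, ← sub_add]
          refine supportedOn_mono (fun x hx => (hS.inv_mul_mem_iff x).2 hx) (T₁ := Pᶜ) ?_
          exact add_mem (supportedOn_mono (fun x hx => hx.2) hfr)
            (supportedOn_mono (fun x hx => hx.2) hh)
        exact fun g hg => Or.inl ⟨hn' g hg, this g hg⟩
    rw [← sub_add_cancel f (r - h)]
    exact add_mem h₂ h₁
  have hM : φ.ker.asSubmodule = M₀ := by
    refine le_antisymm (fun f hf => hker f hf) (Submodule.span_le.2 fun f hf => ?_)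
    have : f ∈ φ.ker.toSubmodule ⊓ supportedOn σ (S N) := hs ▸ Submodule.subset_span hf
    exact this.1
  rw [hM]
  exact Submodule.fg_span s.finite_toSet

theorem finiteDimensional_edgeSpace_of_fg [Finite ι] [FiniteDimensional k V]
    (hS : IsHalfTree H w c P S) (hH : IsOpen (H : Set G)) (hfg : φ.ker.asSubmodule.FG) :
    FiniteDimensional k (edgeSpace σ P φ) := by
  classical
  obtain ⟨s, hs⟩ := hfg
  obtain ⟨m, hm⟩ := hS.exists_forall_mem_supportedOn_ball (σ := σ) hH
    (α := (cInd H σ).asModule) s fun f => (f : cIndSpace H σ)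
  have hsker : ∀ f ∈ s, f ∈ φ.ker.asSubmodule := fun f hf => hs ▸ Submodule.subset_span hf
  let Q : Submodule k (cIndSpace H σ) := (φ.ker.toSubmodule ⊓ supportedOn σ P) ⊔
    (φ.ker.toSubmodule ⊓ supportedOn σ Pᶜ) ⊔ supportedOn σ (S (m + 1 + m))
  have htrans : ∀ g, ∀ f ∈ s, cInd H σ g f ∈ Q := by
    intro g f hf
    have hg : ∀ T : Set G, (∀ x ∈ S m, g * x ∈ T) → cInd H σ g f ∈ supportedOn σ T := fun T hT =>
      (cInd_mem_supportedOn g).2 (supportedOn_mono hT (hm f hf))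
    have hk : cInd H σ g f ∈ φ.ker.toSubmodule := φ.ker.apply_mem_toSubmodule g (hsker f hf)
    -- Either the translated ball stays near the base edge, or it lies on one side of it.
    by_cases hgm : g ∈ S (m + 1)
    · exact Submodule.mem_sup_right (hg _ fun x hx => hS.mul_mem_ball hgm hx)
    · rcases hS.translate_ball hgm with h | h
      · exact Submodule.mem_sup_left (Submodule.mem_sup_left ⟨hk, hg _ h⟩)
      · exact Submodule.mem_sup_left (Submodule.mem_sup_right ⟨hk, hg _ h⟩)
  have hQ : ∀ f, φ f = 0 → f ∈ Q := by
    intro f hf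
    have hf' : f ∈ φ.ker.asSubmodule := hf
    rw [← hs] at hf'
    -- `Q` need not be stable under `G`, so the induction over the `k[G]`-span has to carry all
    -- translates at once.
    have hg : ∀ g, cInd H σ g f ∈ Q := by
      refine Submodule.span_induction (p := fun (f : (cInd H σ).asModule) _ =>
        ∀ g, cInd H σ g f ∈ Q) (fun f hf g => htrans g f hf) (fun g => ?_)
        (fun f₁ f₂ _ _ h₁ h₂ g => ?_) (fun a f _ h => ?_) hf'
      · exact (map_zero (cInd H σ g)).symm ▸ zero_mem Q
      · exact (map_add (cInd H σ g) f₁ f₂).symm ▸ add_mem (h₁ g) (h₂ g)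
      · induction a using MonoidAlgebra.induction_linear with
        | zero => intro g; rw [zero_smul]; exact (map_zero (cInd H σ g)).symm ▸ zero_mem Q
        | add x y hx hy =>
          intro g
          rw [add_smul]
          exact (map_add (cInd H σ g) (x • f) (y • f)).symm ▸ add_mem (hx g) (hy g)
        | single g' a =>
          intro g
          rw [Representation.single_smul]
          have := Q.smul_mem a (h (g * g'))
          rw [map_mul] at this
          exact (map_smul (cInd H σ g) a (cInd H σ g' f)).symm ▸ this
    simpa using hg 1
  have hfin := finiteDimensional_supportedOn (σ := σ) (hS.finCosets_ball (m + 1 + m))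
  let E := (supportedOn σ (S (m + 1 + m))).map (φ.toLinearMap ∘ₗ restrict hH hS.rightStable)
  have hE : FiniteDimensional k E := inferInstance
  refine Submodule.finiteDimensional_of_le (S₂ := E) ?_
  rintro x ⟨⟨f₁, hf₁, rfl⟩, ⟨f₂, hf₂, hx⟩⟩
  have hker : φ (f₁ - f₂) = 0 := by rw [map_sub, sub_eq_zero]; exact hx.symm
  obtain ⟨q, hq, t, ht, hqt⟩ := Submodule.mem_sup.1 (hQ _ hker)
  obtain ⟨r₁, hr₁, r₂, hr₂, rfl⟩ := Submodule.mem_sup.1 hq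
  let t₁ := restrict hH hS.rightStable t
  have ht₁ : t₁ ∈ supportedOn σ P :=
    supportedOn_mono Set.inter_subset_left (restrict_mem hH _ ht)
  have ht₂ : t - t₁ ∈ supportedOn σ Pᶜ :=
    supportedOn_mono (fun x hx => hx.2) (sub_restrict_mem hH _ ht)
  -- In `f₁ - f₂ = r₁ + r₂ + t`, the terms on `P` and those off `P` must balance separately.
  have hzero : f₁ - r₁ - t₁ = 0 := by
    refine eq_zero_of_mem_supportedOn (T := P) (T' := Pᶜ) (sub_mem (sub_mem hf₁ hr₁.2) ht₁) ?_
      disjoint_compl_right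
    have : f₁ - r₁ - t₁ = f₂ + r₂ + (t - t₁) := by
      have : f₁ = f₂ + (r₁ + r₂ + t) := by rw [hqt]; abel
      rw [this]; abel
    rw [this]
    exact add_mem (add_mem hf₂ hr₂.2) ht₂
  refine ⟨t, ht, ?_⟩
  have hf : f₁ = r₁ + t₁ := by rw [← sub_eq_zero, ← sub_sub]; exact hzero
  have hr : φ r₁ = 0 := hr₁.1
  show φ t₁ = φ f₁
  rw [hf, map_add, hr, zero_add]

end IsHalfTree

end Quotients

/-! ### Lengths of rows of `2 × 2` matrices -/

section RowNorms

open Matrix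

variable {F : Type*} [Field F] [ValuativeRel F]

/-- The maximum of the valuations of the two entries of a vector. -/
def vecVal (r : Fin 2 → F) : ValuativeRel.ValueGroupWithZero F :=
  max (ValuativeRel.valuation F (r 0)) (ValuativeRel.valuation F (r 1))

/-- The maximum of the valuations of the entries of a `2 × 2` matrix. -/
def matVal (A : Matrix (Fin 2) (Fin 2) F) : ValuativeRel.ValueGroupWithZero F :=
  max (vecVal (A 0)) (vecVal (A 1))

local notation "ν" => ValuativeRel.valuation F

theorem val_le_vecVal (r : Fin 2 → F) (i : Fin 2) : ν (r i) ≤ vecVal r := by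
  fin_cases i
  · exact le_max_left _ _
  · exact le_max_right _ _

theorem vecVal_le {r : Fin 2 → F} {γ : ValuativeRel.ValueGroupWithZero F} (h : ∀ i, ν (r i) ≤ γ) :
    vecVal r ≤ γ :=
  max_le (h 0) (h 1)

theorem vecVal_le_matVal (A : Matrix (Fin 2) (Fin 2) F) (i : Fin 2) : vecVal (A i) ≤ matVal A := by
  fin_cases i
  · exact le_max_left _ _
  · exact le_max_right _ _

theorem val_le_matVal (A : Matrix (Fin 2) (Fin 2) F) (i j : Fin 2) : ν (A i j) ≤ matVal A :=
  (val_le_vecVal (A i) j).trans (vecVal_le_matVal A i)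

theorem matVal_le {A : Matrix (Fin 2) (Fin 2) F} {γ : ValuativeRel.ValueGroupWithZero F}
    (h : ∀ i j, ν (A i j) ≤ γ) : matVal A ≤ γ :=
  max_le (vecVal_le (h 0)) (vecVal_le (h 1))

theorem vecVal_smul (a : F) (r : Fin 2 → F) : vecVal (a • r) = ν a * vecVal r := by
  simp [vecVal, mul_max]

theorem vecVal_add_le (r s : Fin 2 → F) : vecVal (r + s) ≤ max (vecVal r) (vecVal s) :=
  vecVal_le fun i => ((ν).map_add _ _).trans (max_le_max (val_le_vecVal r i) (val_le_vecVal s i))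

theorem vecVal_vecMul_le (r : Fin 2 → F) (A : Matrix (Fin 2) (Fin 2) F) :
    vecVal (r ᵥ* A) ≤ vecVal r * matVal A := by
  refine vecVal_le fun j => ?_
  have : (r ᵥ* A) j = r 0 * A 0 j + r 1 * A 1 j := by
    simp [Matrix.vecMul, dotProduct, Fin.sum_univ_two]
  rw [this]
  refine ((ν).map_add _ _).trans (max_le ?_ ?_) <;> rw [map_mul] <;>
    exact mul_le_mul' (val_le_vecVal r _) (val_le_matVal A _ j)

theorem matVal_adjugate_le (A : Matrix (Fin 2) (Fin 2) F) : matVal A.adjugate ≤ matVal A := by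
  rw [Matrix.adjugate_fin_two]
  refine matVal_le fun i j => ?_
  fin_cases i <;> fin_cases j <;> simp [val_le_matVal]

/-- Multiplying back by the adjugate, whose entries are no larger than those of `A`, bounds how much
`A` can shrink a row. -/
theorem vecVal_mul_val_det_le (r : Fin 2 → F) (A : Matrix (Fin 2) (Fin 2) F) :
    vecVal r * ν A.det ≤ vecVal (r ᵥ* A) * matVal A := by
  have : (r ᵥ* A) ᵥ* A.adjugate = A.det • r := by
    rw [Matrix.vecMul_vecMul, Matrix.mul_adjugate, Matrix.vecMul_smul, Matrix.vecMul_one]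
  calc vecVal r * ν A.det = vecVal ((r ᵥ* A) ᵥ* A.adjugate) := by
        rw [this, vecVal_smul, mul_comm]
    _ ≤ vecVal (r ᵥ* A) * matVal A.adjugate := vecVal_vecMul_le _ _
    _ ≤ _ := mul_le_mul' le_rfl (matVal_adjugate_le A)

theorem matVal_mul_le (A B : Matrix (Fin 2) (Fin 2) F) : matVal (A * B) ≤ matVal A * matVal B := by
  refine max_le ?_ ?_ <;> rw [Matrix.mul_apply_eq_vecMul] <;>
    exact (vecVal_vecMul_le _ _).trans (mul_le_mul' (vecVal_le_matVal A _) le_rfl)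

theorem vecVal_pos (g : GL (Fin 2) F) (i : Fin 2) : 0 < vecVal (g.val i) := by
  by_contra h
  have h0 : vecVal (g.val i) = 0 := by simpa using h
  have hz : ∀ j, g.val i j = 0 := fun j => by
    have := val_le_vecVal (g.val i) j
    rw [h0] at this
    simpa using this
  exact g.det_ne_zero (Matrix.det_eq_zero_of_row_eq_zero i hz)

theorem matVal_pos (g : GL (Fin 2) F) : 0 < matVal g.val :=
  (vecVal_pos g 0).trans_le (vecVal_le_matVal _ _)

/-- Subtracting a multiple of the second row makes the first row as short as the determinant
allows. -/
theorem exists_vecVal_sub_smul_mul_le (A : Matrix (Fin 2) (Fin 2) F)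
    (h0 : vecVal (A 1) ≠ 0) (h : vecVal (A 0) ≤ vecVal (A 1)) :
    ∃ b : F, ν b ≤ 1 ∧ vecVal (A 0 - b • A 1) * vecVal (A 1) ≤ ν A.det := by
  obtain ⟨j, hj⟩ : ∃ j, vecVal (A 1) = ν (A 1 j) := by
    rcases max_choice (ν (A 1 0)) (ν (A 1 1)) with h | h
    exacts [⟨0, h⟩, ⟨1, h⟩]
  rw [hj] at h0
  have hne : A 1 j ≠ 0 := (ν).ne_zero_iff.1 h0
  -- With `A 1 j` the largest entry of the second row, this multiple cancels the `j`-th entry of the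
  -- first row; the other entry times `A 1 j` is then the determinant up to sign.
  refine ⟨A 0 j / A 1 j, ?_, ?_⟩
  · rw [map_div₀]
    exact div_le_one_of_le₀ ((val_le_vecVal (A 0) j).trans (h.trans hj.le)) zero_le
  · rw [hj, mul_comm, ← vecVal_smul]
    refine vecVal_le fun l => ?_
    have : (A 1 j • (A 0 - (A 0 j / A 1 j) • A 1)) l = A 1 j * A 0 l - A 0 j * A 1 l := by
      simp only [Pi.smul_apply, Pi.sub_apply, smul_eq_mul]
      field_simp
    rw [this, Matrix.det_fin_two]
    fin_cases j <;> fin_cases l <;> simp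
    · simp [mul_comm]
    · rw [(ν).map_sub_swap]; exact le_of_eq (by ring_nf)
    · exact le_of_eq (by ring_nf)
    · simp [mul_comm]

end RowNorms

theorem val_mul_scalar {F : Type*} [Field F] (g : GL (Fin 2) F) (u : Fˣ) :
    (g * Matrix.GeneralLinearGroup.scalar (Fin 2) u).val = (u : F) • g.val := by
  rw [Units.val_mul, Matrix.GeneralLinearGroup.coe_scalar, Matrix.scalar_apply,
    ← Matrix.smul_one_eq_diagonal, Matrix.mul_smul, Matrix.mul_one]

/-! ### The half-tree in `GL₂(F)` -/

section HalfTree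

open Matrix

variable {F : Type*} [Field F] [ValuativeRel F] {ϖ : 𝒪[F]}

local notation "ν" => ValuativeRel.valuation F

theorem val_lt_one_of_irreducible (hϖ : Irreducible ϖ) : ν (ϖ : F) < 1 := by
  refine lt_of_le_of_ne ϖ.2 fun h => hϖ.not_isUnit ?_
  exact ((Valuation.integer.integers ν).isUnit_iff_valuation_eq_one).2 h

theorem val_pos_of_irreducible (hϖ : Irreducible ϖ) : 0 < ν (ϖ : F) := by
  have : (ϖ : F) ≠ 0 := by simpa using hϖ.ne_zero
  exact (ν).pos_iff.2 this

/-- The scalar matrix `ϖ`, as an element of `KZ`. -/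
def scalarUniformizer (hϖ : Irreducible ϖ) : KZ F :=
  ⟨Matrix.GeneralLinearGroup.scalar (Fin 2) (Units.mk0 (ϖ : F) (by simpa using hϖ.ne_zero)),
    Subgroup.mem_sup_right (by
      rw [Matrix.GeneralLinearGroup.center_eq_range_scalar]; exact ⟨_, rfl⟩)⟩

theorem scalarUniformizer_mul (hϖ : Irreducible ϖ) (g : KZ F) :
    scalarUniformizer hϖ * g = g * scalarUniformizer hϖ :=
  Subtype.ext (Matrix.GeneralLinearGroup.scalar_commute _ _)

theorem matVal_smul (a : F) (A : Matrix (Fin 2) (Fin 2) F) : matVal (a • A) = ν a * matVal A := by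
  simp only [matVal, mul_max, ← vecVal_smul]
  rfl

theorem exists_matVal_eq (A : Matrix (Fin 2) (Fin 2) F) : ∃ i j, matVal A = ν (A i j) := by
  rcases max_choice (vecVal (A 0)) (vecVal (A 1)) with h | h <;>
    [rcases max_choice (ν (A 0 0)) (ν (A 0 1)) with h' | h';
      rcases max_choice (ν (A 1 0)) (ν (A 1 1)) with h' | h']
  exacts [⟨0, 0, h.trans h'⟩, ⟨0, 1, h.trans h'⟩, ⟨1, 0, h.trans h'⟩, ⟨1, 1, h.trans h'⟩]

theorem val_det_le (A : Matrix (Fin 2) (Fin 2) F) : ν A.det ≤ matVal A ^ 2 := by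
  rw [Matrix.det_fin_two, sq]
  refine ((ν).map_sub _ _).trans (max_le ?_ ?_) <;> rw [map_mul] <;>
    exact mul_le_mul' (val_le_matVal A _ _) (val_le_matVal A _ _)

theorem mem_K_of_val {g : GL (Fin 2) F} (h : matVal g.val ≤ 1) (hd : ν g.val.det = 1) :
    g ∈ K F := by
  let A : Matrix (Fin 2) (Fin 2) 𝒪[F] :=
    Matrix.of fun i j => ⟨g.val i j, (val_le_matVal g.val i j).trans h⟩
  have hA : (algebraMap 𝒪[F] F).mapMatrix A = g.val := rfl
  have hdet : algebraMap 𝒪[F] F A.det = g.val.det := by rw [RingHom.map_det, hA]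
  have hu : IsUnit A.det := by
    rw [(Valuation.integer.integers ν).isUnit_iff_valuation_eq_one, hdet, hd]
  exact ⟨Matrix.GeneralLinearGroup.mk'' A hu, Units.ext hA⟩

/-- The reverse inequality is `val_det_le`, so the condition is an equality; dividing by an entry of
largest valuation then gives an element of `K`. -/
theorem mem_KZ_iff {g : GL (Fin 2) F} : g ∈ KZ F ↔ matVal g.val ^ 2 ≤ ν g.val.det := by
  constructor
  · intro hg
    rw [← SetLike.mem_coe, KZ, Subgroup.mul_normal] at hg
    obtain ⟨_, ⟨x, rfl⟩, z, hz, rfl⟩ := hg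
    obtain ⟨a, ha⟩ := Matrix.GeneralLinearGroup.mem_center_iff_val_mem_range_scalar.1 hz
    let X : GL (Fin 2) F := Matrix.GeneralLinearGroup.map (algebraMap 𝒪[F] F) x
    have hval : (X * z).val = a • X.val := by
      rw [Units.val_mul, ← ha, Matrix.scalar_apply, ← Matrix.smul_one_eq_diagonal, Matrix.mul_smul,
        Matrix.mul_one]
    have hX : matVal X.val ≤ 1 := matVal_le fun i j => (x.val i j).2
    have hdet : ν X.val.det = 1 := by
      have : X.val.det = algebraMap 𝒪[F] F x.val.det := (RingHom.map_det _ _).symm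
      rw [this]
      exact (Valuation.integer.integers ν).isUnit_iff_valuation_eq_one.1
        (x.isUnit.map Matrix.detMonoidHom)
    show matVal (X * z).val ^ 2 ≤ ν (X * z).val.det
    rw [hval, matVal_smul, Matrix.det_smul, Fintype.card_fin, map_mul, map_pow, hdet, mul_one]
    exact pow_le_pow_left' (mul_le_of_le_one_right' hX) 2
  · intro h
    obtain ⟨i, j, hij⟩ := exists_matVal_eq g.val
    generalize g.val i j = a at hij
    have ha : a ≠ 0 := (ν).ne_zero_iff.1 (hij ▸ (matVal_pos g).ne')
    have hva : ν a ≠ 0 := (ν).ne_zero_iff.2 ha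
    let z : GL (Fin 2) F := Matrix.GeneralLinearGroup.scalar (Fin 2) (Units.mk0 a ha)
    have hz : z ∈ Subgroup.center (GL (Fin 2) F) := by
      rw [Matrix.GeneralLinearGroup.center_eq_range_scalar]
      exact ⟨_, rfl⟩
    have hval : (g * z⁻¹).val = a⁻¹ • g.val := by
      rw [← map_inv, val_mul_scalar, Units.val_inv_eq_inv_val, Units.val_mk0]
    have hK : g * z⁻¹ ∈ K F := by
      apply mem_K_of_val
      · rw [hval, matVal_smul, hij, map_inv₀, inv_mul_cancel₀ hva]
      · have := le_antisymm (val_det_le g.val) h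
        rw [hval, Matrix.det_smul, Fintype.card_fin, map_mul, this, hij, ← map_pow, ← map_mul,
          inv_pow, inv_mul_cancel₀ (pow_ne_zero 2 ha), map_one]
    have := Subgroup.mul_mem (KZ F) (Subgroup.mem_sup_left hK) (Subgroup.mem_sup_right hz)
    rwa [inv_mul_cancel_right] at this

/-- On `KZ` the upper and lower bounds for the length of `r ᵥ* h` coincide, so both rows scale alike
and comparing them is a condition on cosets. -/
theorem vecVal_vecMul_of_mem_KZ {h : GL (Fin 2) F} (hh : h ∈ KZ F) (r : Fin 2 → F) :
    vecVal (r ᵥ* h.val) = vecVal r * matVal h.val := by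
  refine le_antisymm (vecVal_vecMul_le _ _) (le_of_mul_le_mul_right ?_ (matVal_pos h))
  refine le_trans ?_ (vecVal_mul_val_det_le r h.val)
  rw [mul_assoc, ← sq]
  exact mul_le_mul' le_rfl (mem_KZ_iff.1 hh)

variable (F) in
/-- The matrices whose first row is no longer than the second. -/
def halfTree : Set (GL (Fin 2) F) := {g | vecVal (g.val 0) ≤ vecVal (g.val 1)}

/-- The matrices `g` such that the vertex `g KZ` has distance at most `n` from `KZ`. -/
def ball (ϖ : 𝒪[F]) (n : ℕ) : Set (GL (Fin 2) F) :=
  {g | matVal g.val ^ 2 * ν (ϖ : F) ^ n ≤ ν g.val.det}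

/-- The matrix `(ϖ b; 0 1)`. -/
def branch (hϖ : Irreducible ϖ) (b : 𝒪[F]) : GL (Fin 2) F :=
  Matrix.GeneralLinearGroup.mkOfDetNeZero !![(ϖ : F), (b : F); 0, 1] (by
    simpa [Matrix.det_fin_two] using hϖ.ne_zero)

theorem matVal_eq_of_mem_halfTree {g : GL (Fin 2) F} (hg : g ∈ halfTree F) :
    matVal g.val = vecVal (g.val 1) :=
  max_eq_right hg

theorem Pi_mul_zero (hϖ : Irreducible ϖ) (y : GL (Fin 2) F) :
    (Pi ϖ hϖ * y).val 0 = y.val 1 := by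
  ext j
  simp [Pi, Matrix.mul_apply, Fin.sum_univ_two]

theorem Pi_mul_one (hϖ : Irreducible ϖ) (y : GL (Fin 2) F) :
    (Pi ϖ hϖ * y).val 1 = (ϖ : F) • y.val 0 := by
  ext j
  simp [Pi, Matrix.mul_apply, Fin.sum_univ_two]

theorem val_det_Pi_mul (hϖ : Irreducible ϖ) (y : GL (Fin 2) F) :
    ν (Pi ϖ hϖ * y).val.det = ν (ϖ : F) * ν y.val.det := by
  rw [Units.val_mul, Matrix.det_mul, map_mul]
  simp [Pi, Matrix.det_fin_two]

theorem branch_mul_zero (hϖ : Irreducible ϖ) (b : 𝒪[F]) (y : GL (Fin 2) F) :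
    (branch hϖ b * y).val 0 = (ϖ : F) • y.val 0 + (b : F) • y.val 1 := by
  ext j
  simp [branch, Matrix.mul_apply, Fin.sum_univ_two]

theorem branch_mul_one (hϖ : Irreducible ϖ) (b : 𝒪[F]) (y : GL (Fin 2) F) :
    (branch hϖ b * y).val 1 = y.val 1 := by
  ext j
  simp [branch, Matrix.mul_apply, Fin.sum_univ_two]

theorem val_det_branch_mul (hϖ : Irreducible ϖ) (b : 𝒪[F]) (y : GL (Fin 2) F) :
    ν (branch hϖ b * y).val.det = ν (ϖ : F) * ν y.val.det := by
  rw [Units.val_mul, Matrix.det_mul, map_mul]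
  simp [branch, Matrix.det_fin_two]

theorem mul_mem_ball {m n : ℕ} {g x : GL (Fin 2) F} (hg : g ∈ ball ϖ m) (hx : x ∈ ball ϖ n) :
    g * x ∈ ball ϖ (m + n) := by
  show matVal (g * x).val ^ 2 * _ ≤ ν (g * x).val.det
  rw [Units.val_mul, Matrix.det_mul, map_mul]
  calc matVal (g.val * x.val) ^ 2 * ν (ϖ : F) ^ (m + n)
      ≤ (matVal g.val * matVal x.val) ^ 2 * ν (ϖ : F) ^ (m + n) :=
        mul_le_mul' (pow_le_pow_left' (matVal_mul_le _ _) 2) le_rfl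
    _ = (matVal g.val ^ 2 * ν (ϖ : F) ^ m) * (matVal x.val ^ 2 * ν (ϖ : F) ^ n) := by
        rw [mul_pow, pow_add]; ac_rfl
    _ ≤ _ := mul_le_mul' hg hx

theorem ball_zero : ball ϖ 0 = (KZ F : Set (GL (Fin 2) F)) := by
  ext g
  rw [SetLike.mem_coe, mem_KZ_iff]
  simp [ball]

theorem ball_mono : Monotone (ball ϖ) := fun m n hmn g hg =>
  (mul_le_mul' le_rfl (pow_le_pow_right_of_le_one' ϖ.2 hmn) :
    matVal g.val ^ 2 * ν (ϖ : F) ^ n ≤ matVal g.val ^ 2 * ν (ϖ : F) ^ m).trans hg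

theorem mem_KZ_of_forall_le {x : GL (Fin 2) F} (hx : x ∈ halfTree F)
    (h : ∀ b : F, ν b ≤ 1 → vecVal (x.val 1) ≤ vecVal (x.val 0 - b • x.val 1)) : x ∈ KZ F := by
  obtain ⟨b, hb, hle⟩ := exists_vecVal_sub_smul_mul_le x.val (vecVal_pos x 1).ne' hx
  rw [mem_KZ_iff, matVal_eq_of_mem_halfTree hx, sq]
  exact (mul_le_mul' (h b hb) le_rfl).trans hle

/-- Far from the root, the first row of `g` is an integral multiple of the second plus a remainder
shorter by a factor `ν ϖ ^ m`. An `x` in the ball of radius `m` distorts lengths by at most this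
factor, so it cannot make the first row the longer one. -/
theorem mul_mem_halfTree_of_notMem_ball {m : ℕ} {g x : GL (Fin 2) F} (hg : g ∈ halfTree F)
    (hgm : g ∉ ball ϖ m) (hx : x ∈ ball ϖ m) : g * x ∈ halfTree F := by
  obtain ⟨b, hb, hle⟩ := exists_vecVal_sub_smul_mul_le g.val (vecVal_pos g 1).ne' hg
  have hpos := vecVal_pos g 1
  have hgm' : ν g.val.det < vecVal (g.val 1) ^ 2 * ν (ϖ : F) ^ m := by
    rw [← matVal_eq_of_mem_halfTree hg]; exact not_le.1 hgm
  have hshort : vecVal (g.val 0 - b • g.val 1) ≤ vecVal (g.val 1) * ν (ϖ : F) ^ m := by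
    refine le_of_mul_le_mul_right ?_ hpos
    refine hle.trans (hgm'.le.trans (le_of_eq ?_))
    rw [sq]; ac_rfl
  have hlong : vecVal (g.val 1) * ν (ϖ : F) ^ m * matVal x.val ≤ vecVal (g.val 1 ᵥ* x.val) := by
    refine le_of_mul_le_mul_right ?_ (matVal_pos x)
    refine le_trans ?_ (vecVal_mul_val_det_le (g.val 1) x.val)
    refine le_trans (le_of_eq ?_) (mul_le_mul' le_rfl hx)
    rw [sq]; ac_rfl
  show vecVal ((g * x).val 0) ≤ vecVal ((g * x).val 1)
  rw [Units.val_mul, Matrix.mul_apply_eq_vecMul, Matrix.mul_apply_eq_vecMul]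
  have hsplit : g.val 0 ᵥ* x.val = (g.val 0 - b • g.val 1) ᵥ* x.val + b • (g.val 1 ᵥ* x.val) := by
    rw [Matrix.sub_vecMul, Matrix.smul_vecMul, sub_add_cancel]
  rw [hsplit]
  refine (vecVal_add_le _ _).trans (max_le ?_ ?_)
  · exact (vecVal_vecMul_le _ _).trans ((mul_le_mul' hshort le_rfl).trans hlong)
  · rw [vecVal_smul]
    exact mul_le_of_le_one_left' hb

theorem mem_ball_of_Pi_mul_mem (hϖ : Irreducible ϖ) {n : ℕ} {y : GL (Fin 2) F}
    (hy : y ∈ halfTree F) (h : Pi ϖ hϖ * y ∈ ball ϖ n) : y ∈ ball ϖ n := by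
  have h' : matVal (Pi ϖ hϖ * y).val ^ 2 * ν (ϖ : F) ^ n ≤ ν (ϖ : F) * ν y.val.det :=
    val_det_Pi_mul hϖ y ▸ h
  have hle : matVal y.val ≤ matVal (Pi ϖ hϖ * y).val := by
    rw [matVal_eq_of_mem_halfTree hy, ← Pi_mul_zero hϖ]
    exact vecVal_le_matVal _ 0
  exact (mul_le_mul' (pow_le_pow_left' hle 2) le_rfl).trans
    (h'.trans (mul_le_of_le_one_left' ϖ.2))

theorem Pi_mul_mem_ball (hϖ : Irreducible ϖ) {n : ℕ} {y : GL (Fin 2) F}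
    (hy : y ∈ ball ϖ n) : Pi ϖ hϖ * y ∈ ball ϖ (n + 1) := by
  have hle : matVal (Pi ϖ hϖ * y).val ≤ matVal y.val := by
    refine max_le ?_ ?_
    · rw [Pi_mul_zero]; exact vecVal_le_matVal _ 1
    · rw [Pi_mul_one, vecVal_smul]
      exact (mul_le_of_le_one_left' ϖ.2).trans (vecVal_le_matVal _ 0)
  show _ ≤ ν (Pi ϖ hϖ * y).val.det
  rw [val_det_Pi_mul, pow_succ _ n, ← mul_assoc, mul_comm (ν (ϖ : F)) (ν y.val.det)]
  exact mul_le_mul' ((mul_le_mul' (pow_le_pow_left' hle 2) le_rfl).trans hy) le_rfl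

theorem mem_ball_of_branch_mul_mem (hϖ : Irreducible ϖ) (b : 𝒪[F]) {n : ℕ} {y : GL (Fin 2) F}
    (hy : y ∈ halfTree F) (h : branch hϖ b * y ∈ ball ϖ (n + 1)) : y ∈ ball ϖ n := by
  have h' : matVal (branch hϖ b * y).val ^ 2 * ν (ϖ : F) ^ (n + 1) ≤ ν (ϖ : F) * ν y.val.det :=
    val_det_branch_mul hϖ b y ▸ h
  have hle : matVal y.val ≤ matVal (branch hϖ b * y).val := by
    rw [matVal_eq_of_mem_halfTree hy, ← branch_mul_one hϖ b]
    exact vecVal_le_matVal _ 1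
  refine le_of_mul_le_mul_right ?_ (val_pos_of_irreducible hϖ)
  rw [mul_assoc, ← pow_succ, mul_comm (ν y.val.det)]
  exact (mul_le_mul' (pow_le_pow_left' hle 2) le_rfl).trans h'

/-- Geometrically, the translate of the base edge by `branch hϖ b` ends at the root `KZ`. -/
theorem branch_mul_Pi_mem (hϖ : Irreducible ϖ) (b : 𝒪[F]) : branch hϖ b * Pi ϖ hϖ ∈ KZ F := by
  have hval : (branch hϖ b * Pi ϖ hϖ).val = !![(ϖ : F) * b, ϖ; (ϖ : F), 0] := by
    ext i j
    fin_cases i <;> fin_cases j <;>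
      simp [branch, Pi, Matrix.mul_apply, Fin.sum_univ_two, mul_comm]
  rw [mem_KZ_iff, hval]
  have hle : matVal !![(ϖ : F) * b, ϖ; (ϖ : F), 0] ≤ ν (ϖ : F) := by
    refine matVal_le fun i j => ?_
    fin_cases i <;> fin_cases j <;> simp
    exact mul_le_of_le_one_right' b.2
  refine (pow_le_pow_left' hle 2).trans (le_of_eq ?_)
  simp [Matrix.det_fin_two, sq]

theorem val_sub_lt_one_of_branch (hϖ : Irreducible ϖ) {b b' : 𝒪[F]} {y z : GL (Fin 2) F}
    (hy : y ∈ halfTree F) (hz : z ∈ halfTree F) (h : branch hϖ b * y = branch hϖ b' * z) :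
    ν ((b : F) - b') < 1 := by
  have h1 : y.val 1 = z.val 1 := by
    rw [← branch_mul_one hϖ b, h, branch_mul_one]
  have h0 : (ϖ : F) • y.val 0 + (b : F) • y.val 1 = (ϖ : F) • z.val 0 + (b' : F) • z.val 1 := by
    rw [← branch_mul_zero hϖ b, h, branch_mul_zero]
  have hs : ((b : F) - b') • y.val 1 = (ϖ : F) • (z.val 0 + (-1 : F) • y.val 0) := by
    rw [← h1] at h0
    rw [sub_smul, smul_add, smul_smul, mul_neg_one, neg_smul, ← sub_eq_add_neg,
      sub_eq_sub_iff_add_eq_add, add_comm, h0]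
  have hle : ν ((b : F) - b') * vecVal (y.val 1) ≤ ν (ϖ : F) * vecVal (y.val 1) := by
    rw [← vecVal_smul, hs, vecVal_smul]
    refine mul_le_mul' le_rfl ((vecVal_add_le _ _).trans (max_le ?_ ?_))
    · rw [h1]; exact hz
    · rw [vecVal_smul, (ν).map_neg, map_one, one_mul]; exact hy
  exact (le_of_mul_le_mul_right hle (vecVal_pos y 1)).trans_lt (val_lt_one_of_irreducible hϖ)

/-- A representative in `𝒪` of an element of the residue field. -/
def residueLift (i : 𝓀[F]) : 𝒪[F] := Function.surjInv (IsLocalRing.residue_surjective) i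

theorem residue_residueLift (i : 𝓀[F]) : IsLocalRing.residue 𝒪[F] (residueLift i) = i :=
  Function.surjInv_eq _ i

theorem residue_eq_iff {b b' : 𝒪[F]} :
    IsLocalRing.residue 𝒪[F] b = IsLocalRing.residue 𝒪[F] b' ↔ ν ((b : F) - b') < 1 := by
  rw [← sub_eq_zero, ← map_sub, IsLocalRing.residue_eq_zero_iff, IsLocalRing.mem_maximalIdeal,
    mem_nonunits_iff, (Valuation.integer.integers ν).isUnit_iff_valuation_eq_one]
  exact ⟨fun h => lt_of_le_of_ne (b - b').2 h, fun h => h.ne⟩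

theorem isRightStable_halfTree : IsRightStable (KZ F) (halfTree F) := by
  intro g hg h hh
  show vecVal ((g * h).val 0) ≤ vecVal ((g * h).val 1)
  rw [Units.val_mul, Matrix.mul_apply_eq_vecMul, Matrix.mul_apply_eq_vecMul,
    vecVal_vecMul_of_mem_KZ hh, vecVal_vecMul_of_mem_KZ hh]
  exact mul_le_mul' hg le_rfl

theorem PPlus_subset_halfTree : PPlus F ⊆ halfTree F := by
  rintro g ⟨a, b, -, hg⟩
  show vecVal (g.val 0) ≤ vecVal (g.val 1)
  have h1 : vecVal (g.val 1) = 1 := by simp [vecVal, hg]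
  rw [h1]
  refine vecVal_le fun i => ?_
  rw [hg]
  fin_cases i
  · exact a.2
  · exact b.2

theorem exists_mem_PPlus_inv_mul_mem_KZ {g : GL (Fin 2) F} (hg : g ∈ halfTree F) :
    ∃ t ∈ PPlus F, t⁻¹ * g ∈ KZ F := by
  obtain ⟨b, hb, hle⟩ := exists_vecVal_sub_smul_mul_le g.val (vecVal_pos g 1).ne' hg
  obtain ⟨c, hc⟩ := ValuativeRel.valuation_surjective (vecVal (g.val 1))
  have hcpos : 0 < ν c := hc ▸ vecVal_pos g 1
  have hc0 : c ≠ 0 := (ν).ne_zero_iff.1 hcpos.ne'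
  have hdet : g.val.det ≠ 0 := g.det_ne_zero
  -- This `a` gives `t⁻¹ * g` the determinant `c ^ 2`, with `ν c` the length of its second row; by
  -- `mem_KZ_iff` only the first row remains to be bounded by `ν c`.
  obtain ⟨a, ha⟩ : ∃ a, g.val.det = a * c ^ 2 := ⟨g.val.det / c ^ 2, by field_simp⟩
  have ha0 : a ≠ 0 := by rintro rfl; simp [ha] at hdet
  have hapos : 0 < ν a := (ν).pos_iff.2 ha0
  have ha1 : ν a ≤ 1 := by
    have h := val_det_le g.val
    rw [ha, matVal_eq_of_mem_halfTree hg, ← hc, map_mul, map_pow] at h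
    exact le_of_mul_le_mul_right (by rwa [one_mul]) (pow_pos hcpos 2)
  let t : GL (Fin 2) F := Matrix.GeneralLinearGroup.mkOfDetNeZero !![a, b; 0, 1] (by
    simpa [Matrix.det_fin_two] using ha0)
  refine ⟨t, ⟨⟨a, ha1⟩, ⟨b, hb⟩, fun h => ha0 (congrArg Subtype.val h), rfl⟩, ?_⟩
  obtain ⟨y, rfl⟩ : ∃ y, g = t * y := ⟨t⁻¹ * g, by rw [mul_inv_cancel_left]⟩
  have h0 : (t * y).val 0 = a • y.val 0 + b • y.val 1 := by
    ext j
    simp [t, Matrix.mul_apply, Fin.sum_univ_two]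
  have h1 : (t * y).val 1 = y.val 1 := by
    ext j
    simp [t, Matrix.mul_apply, Fin.sum_univ_two]
  have hd : (t * y).val.det = a * y.val.det := by
    rw [Units.val_mul, Matrix.det_mul]
    simp [t, Matrix.det_fin_two]
  rw [hd] at ha
  rw [inv_mul_cancel_left, mem_KZ_iff, mul_left_cancel₀ ha0 ha, map_pow]
  refine pow_le_pow_left' (max_le ?_ ?_) 2
  · rw [hd, mul_left_cancel₀ ha0 ha, h0, h1, add_sub_cancel_right, vecVal_smul, ← h1, ← hc,
      map_mul, map_pow, sq, mul_assoc] at hle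
    exact le_of_mul_le_mul_right (le_of_mul_le_mul_left hle hapos) hcpos
  · rw [← h1, ← hc]

variable [TopologicalSpace F] [IsNonarchimedeanLocalField F]

theorem val_le_of_val_lt_one (hϖ : Irreducible ϖ) {x : F} (hx : ν x < 1) : ν x ≤ ν (ϖ : F) := by
  have hm : (⟨x, hx.le⟩ : 𝒪[F]) ∈ IsLocalRing.maximalIdeal 𝒪[F] := by
    rw [IsLocalRing.mem_maximalIdeal, mem_nonunits_iff]
    intro hu
    exact hx.ne (((Valuation.integer.integers ν).isUnit_iff_valuation_eq_one).1 hu)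
  rw [(IsDiscreteValuationRing.irreducible_iff_uniformizer ϖ).1 hϖ,
    Ideal.mem_span_singleton] at hm
  obtain ⟨y, hy⟩ := hm
  have : x = ϖ * y := congrArg Subtype.val hy
  rw [this, map_mul]
  exact mul_le_of_le_one_right' y.2

/-- Discreteness of the valuation; this is why `Π` exchanges the two half-trees exactly, with no
overlap or gap. -/
theorem lt_iff_le_val_mul (hϖ : Irreducible ϖ) {a b : ValuativeRel.ValueGroupWithZero F}
    (hb : 0 < b) : a < b ↔ a ≤ ν (ϖ : F) * b := by
  constructor
  · intro h
    obtain ⟨x, hx⟩ := ValuativeRel.valuation_surjective (a / b)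
    have hx1 : ν x < 1 := by rw [hx]; exact (div_lt_one₀ hb).2 h
    have := val_le_of_val_lt_one hϖ hx1
    rwa [hx, div_le_iff₀ hb] at this
  · intro h
    refine h.trans_lt ?_
    simpa using mul_lt_mul_of_pos_right (val_lt_one_of_irreducible hϖ) hb

theorem exists_val_pow_le (hϖ : Irreducible ϖ) {a : ValuativeRel.ValueGroupWithZero F}
    (ha : 0 < a) : ∃ n : ℕ, ν (ϖ : F) ^ n ≤ a := by
  have : MulArchimedean (ValuativeRel.ValueGroupWithZero F) :=
    ValuativeRel.isRankLeOne_iff_mulArchimedean.1 inferInstance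
  obtain ⟨n, hn⟩ := exists_pow_lt₀ (val_lt_one_of_irreducible hϖ) (Units.mk0 a ha.ne')
  exact ⟨n, hn.le⟩

theorem Pi_mul_mem_halfTree_iff (hϖ : Irreducible ϖ) (y : GL (Fin 2) F) :
    Pi ϖ hϖ * y ∈ halfTree F ↔ y ∉ halfTree F := by
  show vecVal _ ≤ vecVal _ ↔ ¬ (vecVal _ ≤ vecVal _)
  rw [Pi_mul_zero, Pi_mul_one, vecVal_smul, not_le, lt_iff_le_val_mul hϖ (vecVal_pos y 0)]

theorem exists_mem_ball (hϖ : Irreducible ϖ) (g : GL (Fin 2) F) : ∃ n, g ∈ ball ϖ n := by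
  have h2 : 0 < matVal g.val ^ 2 := pow_pos (matVal_pos g) 2
  have hd : 0 < ν g.val.det := (ν).pos_iff.2 g.det_ne_zero
  obtain ⟨n, hn⟩ := exists_val_pow_le hϖ (div_pos hd h2)
  exact ⟨n, by rwa [le_div_iff₀' h2] at hn⟩

theorem mem_halfTree_of_branch (hϖ : Irreducible ϖ) {b : 𝒪[F]} {y : GL (Fin 2) F}
    (h : vecVal ((branch hϖ b * y).val 0 - (b : F) • (branch hϖ b * y).val 1) <
      vecVal ((branch hϖ b * y).val 1)) : y ∈ halfTree F := by
  rw [lt_iff_le_val_mul hϖ (vecVal_pos _ 1), branch_mul_zero, branch_mul_one, add_sub_cancel_right,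
    vecVal_smul] at h
  exact le_of_mul_le_mul_left h (val_pos_of_irreducible hϖ)

theorem isHalfTree (hϖ : Irreducible ϖ) :
    IsHalfTree (KZ F) (Pi ϖ hϖ) (fun i : 𝓀[F] => branch hϖ (residueLift i)) (halfTree F)
      (ball ϖ) where
  ball_zero := ball_zero
  ball_mono := ball_mono
  mul_mem_ball := mul_mem_ball
  exists_mem_ball := exists_mem_ball hϖ
  rightStable := isRightStable_halfTree
  inv_mul_mem_iff x := by
    have := Pi_mul_mem_halfTree_iff hϖ ((Pi ϖ hϖ)⁻¹ * x)
    rw [mul_inv_cancel_left] at this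
    rw [this, not_not]
  inv_mul_mem_ball {n x} hx hP := by
    have h1 := Pi_mul_mem_halfTree_iff hϖ ((Pi ϖ hϖ)⁻¹ * x)
    rw [mul_inv_cancel_left] at h1
    refine mem_ball_of_Pi_mul_mem hϖ (not_not.1 (fun h => hP (h1.2 h))) ?_
    rwa [mul_inv_cancel_left]
  branch_mul_mem i := branch_mul_Pi_mem hϖ _
  branch_disjoint {i j x} hi hj := by
    have := val_sub_lt_one_of_branch hϖ (b := residueLift i) (b' := residueLift j) hi hj
      (by rw [mul_inv_cancel_left, mul_inv_cancel_left])
    rwa [← residue_eq_iff, residue_residueLift, residue_residueLift] at this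
  branch_cover {x} hx := by
    by_cases h : ∃ b : F, ν b ≤ 1 ∧ vecVal (x.val 0 - b • x.val 1) < vecVal (x.val 1)
    · obtain ⟨b, hb, hlt⟩ := h
      right
      refine ⟨IsLocalRing.residue 𝒪[F] ⟨b, hb⟩, mem_halfTree_of_branch hϖ
        (b := residueLift (IsLocalRing.residue 𝒪[F] ⟨b, hb⟩)) ?_⟩
      rw [mul_inv_cancel_left]
      generalize hb' : residueLift (IsLocalRing.residue 𝒪[F] ⟨b, hb⟩) = b'
      have hbb : ν (b - b') < 1 := by
        rw [← residue_eq_iff (b := ⟨b, hb⟩), ← hb', residue_residueLift]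
      -- Replacing `b` by the chosen lift of its residue changes the remainder by less than the
      -- length of the second row.
      have : x.val 0 - (b' : F) • x.val 1 =
          (x.val 0 - b • x.val 1) + (b - b') • x.val 1 := by
        rw [sub_smul]; abel
      rw [this]
      refine (vecVal_add_le _ _).trans_lt (max_lt hlt ?_)
      rw [vecVal_smul]
      simpa using mul_lt_mul_of_pos_right hbb (vecVal_pos x 1)
    · push Not at h
      exact Or.inl (mem_KZ_of_forall_le hx h)
  branch_depth {i n x} hP hx := by
    refine mem_ball_of_branch_mul_mem hϖ (residueLift i) hP ?_
    rwa [mul_inv_cancel_left]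
  translate_ball {m g} hg := by
    by_cases hP : g ∈ halfTree F
    · exact Or.inl fun x hx => mul_mem_halfTree_of_notMem_ball hP
        (fun h => hg (ball_mono (Nat.le_succ m) h)) hx
    · right
      intro x hx
      obtain ⟨y, rfl⟩ : ∃ y, g = Pi ϖ hϖ * y := ⟨(Pi ϖ hϖ)⁻¹ * g, by rw [mul_inv_cancel_left]⟩
      rw [Pi_mul_mem_halfTree_iff, not_not] at hP
      rw [mul_assoc, Pi_mul_mem_halfTree_iff, not_not]
      -- The extra `1` in the radius `m + 1` pays for multiplication by `Π`.
      exact mul_mem_halfTree_of_notMem_ball hP (fun h => hg (Pi_mul_mem_ball hϖ h)) hx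

end HalfTree

/-! ### Irreducible representations finitely generated over a central element -/

section Finiteness

variable {k G V : Type*} [Field k] [Group G] [AddCommGroup V] [Module k V]

open Module

/-- A finite faithful module over a finitely generated commutative algebra over a field is
finite-dimensional if it has no submodules of the form `I • ⊤` except for `⊥` and `⊤`. -/
theorem finiteDimensional_of_smul_top_eq {A : Type*} [CommRing A] [Algebra k A]
    [Algebra.FiniteType k A] [Module A V] [IsScalarTower k A V] [Module.Finite A V]
    [FaithfulSMul A V] [Nontrivial V]
    (h : ∀ I : Ideal A, I • (⊤ : Submodule A V) = ⊥ ∨ I • (⊤ : Submodule A V) = ⊤) :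
    FiniteDimensional k V := by
  have hnt : Nontrivial A := Module.nontrivial A V
  obtain ⟨m, hm⟩ := Ideal.exists_maximal A
  -- `m V = 0` gives `m = 0` by faithfulness, while `m V = V` is excluded by Nakayama. So `A` is a
  -- field, and finite over `k` by Zariski's lemma.
  have hmbot : m = ⊥ := by
    rcases h m with h | h
    · rw [eq_bot_iff]
      intro a ha
      refine FaithfulSMul.eq_of_smul_eq_smul (α := V) fun v => ?_
      have hv : a • v ∈ m • (⊤ : Submodule A V) := Submodule.smul_mem_smul ha trivial
      rw [h] at hv
      rw [zero_smul]
      exact hv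
    · exfalso
      obtain ⟨r, hr, hr0⟩ := Submodule.exists_sub_one_mem_and_smul_eq_zero_of_fg_of_le_smul m
        (⊤ : Submodule A V) Module.Finite.fg_top h.ge
      have : r = 0 := FaithfulSMul.eq_of_smul_eq_smul (α := V) fun v => by
        rw [hr0 v trivial, zero_smul]
      rw [this, zero_sub, neg_mem_iff] at hr
      exact hm.ne_top ((Ideal.eq_top_iff_one m).2 hr)
  have hfield : IsField A := Ring.isField_iff_maximal_bot.2 (hmbot ▸ hm)
  let _ : Field A := hfield.toField
  have : Module.Finite k A := finite_of_finite_type_of_isJacobsonRing k A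
  exact Module.Finite.trans A V

open scoped IsMulCommutative in
/-- Let `ρ` be an irreducible representation of `G` over a field, and let `z` be a central element
of `G` such that the translates by the powers of `z` of a finite set span the space. Then the space
is finite-dimensional. -/
theorem finiteDimensional_of_central (ρ : Representation k G V)
    (hρ : ρ.IsIrreducible) {z : G} (hz : ∀ g, z * g = g * z) {s : Set V} (hs : s.Finite)
    (hspan : Submodule.span k {x | ∃ n : ℤ, ∃ v ∈ s, x = ρ (z ^ n) v} = ⊤) :
    FiniteDimensional k V := by
  let T : Set (End k V) := {ρ z, ρ z⁻¹}
  have hcomm : ∀ a ∈ T, ∀ b ∈ T, a * b = b * a := by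
    have h : ρ z * ρ z⁻¹ = ρ z⁻¹ * ρ z := by rw [← map_mul, ← map_mul]; simp
    rintro a (rfl | rfl) b (rfl | rfl)
    exacts [rfl, h, h.symm, rfl]
  obtain ⟨A, hA⟩ : ∃ A, A = Algebra.adjoin k T := ⟨_, rfl⟩
  have hcommA : IsMulCommutative A := hA ▸ Algebra.isMulCommutative_adjoin k hcomm
  have hzA : ∀ n : ℤ, ρ (z ^ n) ∈ A := by
    have h₁ : ρ z ∈ A := by
      rw [hA]
      exact Algebra.subset_adjoin (Set.mem_insert _ _)
    have h₂ : ρ z⁻¹ ∈ A := by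
      rw [hA]
      exact Algebra.subset_adjoin (Set.mem_insert_of_mem _ (Set.mem_singleton _))
    intro n
    obtain ⟨m, rfl | rfl⟩ := n.eq_nat_or_neg
    · rw [zpow_natCast, map_pow]
      exact A.pow_mem h₁ m
    · rw [zpow_neg, zpow_natCast, ← inv_pow, map_pow]
      exact A.pow_mem h₂ m
  have hAρ : ∀ a ∈ A, ∀ g, a * ρ g = ρ g * a := by
    intro a ha g
    have hle : A ≤ Subalgebra.centralizer k {ρ g} := by
      rw [hA]
      refine Algebra.adjoin_le ?_
      have h' : z⁻¹ * g = g * z⁻¹ := by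
        rw [inv_mul_eq_iff_eq_mul, ← mul_assoc, hz, mul_inv_cancel_right]
      rintro b (rfl | rfl) x rfl
      · rw [← map_mul, ← map_mul, hz]
      · rw [← map_mul, ← map_mul, h']
    exact (hle ha (ρ g) rfl).symm
  have hfin : Module.Finite A V := by
    refine ⟨⟨hs.toFinset, ?_⟩⟩
    rw [Set.Finite.coe_toFinset, eq_top_iff]
    intro x _
    have hx : x ∈ Submodule.span k {x | ∃ n : ℤ, ∃ v ∈ s, x = ρ (z ^ n) v} := hspan ▸ trivial
    have hle : Submodule.span k {x | ∃ n : ℤ, ∃ v ∈ s, x = ρ (z ^ n) v} ≤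
        (Submodule.span A s).restrictScalars k := by
      refine Submodule.span_le.2 ?_
      rintro _ ⟨n, v, hv, rfl⟩
      exact Submodule.smul_mem (Submodule.span A s) (⟨_, hzA n⟩ : A) (Submodule.subset_span hv)
    exact hle hx
  have hnontriv : Nontrivial V := by
    by_contra h
    rw [not_nontrivial_iff_subsingleton] at h
    have : (⊥ : Subrepresentation ρ) ≠ ⊤ := bot_ne_top
    exact this (SetLike.ext fun v => by
      rw [Subsingleton.elim v 0]
      exact iff_of_true (zero_mem (⊥ : Subrepresentation ρ).toSubmodule) trivial)
  have hft : Algebra.FiniteType k A :=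
    (Subalgebra.fg_iff_finiteType A).1 ⟨(Set.toFinite T).toFinset, by simp [hA]⟩
  have hfaith : FaithfulSMul A V :=
    ⟨fun {a b} h => Subtype.ext (LinearMap.ext h)⟩
  refine finiteDimensional_of_smul_top_eq (A := A) fun I => ?_
  -- `A` commutes with the action of `G`, so `I V` is a subrepresentation and irreducibility
  -- applies.
  let N : Subrepresentation ρ :=
    { toSubmodule := (I • (⊤ : Submodule A V)).restrictScalars k
      apply_mem_toSubmodule := by
        intro g v hv
        have hv : v ∈ I • (⊤ : Submodule A V) := hv
        show ρ g v ∈ I • (⊤ : Submodule A V)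
        refine Submodule.smul_induction_on hv (fun a ha x _ => ?_) (fun x y hx hy => ?_)
        · have : ρ g (a • x) = a • ρ g x := (LinearMap.congr_fun (hAρ a a.2 g) x).symm
          rw [this]
          exact Submodule.smul_mem_smul ha trivial
        · rw [map_add]
          exact add_mem hx hy }
  rcases hρ.eq_bot_or_eq_top N with h | h
  · left
    rw [eq_bot_iff]
    intro v hv
    have hv : v ∈ N.toSubmodule := hv
    rw [h] at hv
    exact hv
  · right
    rw [eq_top_iff]
    intro v _
    have hv : v ∈ N.toSubmodule := by rw [h]; trivial
    exact hv

end Finiteness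

/-! ### Finite-dimensionality of weights and the description of `I⁺(σ)` -/

section Weights

variable {F : Type*} [Field F] [ValuativeRel F] [TopologicalSpace F] [IsNonarchimedeanLocalField F]
  {ϖ : 𝒪[F]}

local notation "ν" => ValuativeRel.valuation F

theorem exists_val_eq_zpow (hϖ : Irreducible ϖ) {x : F} (hx : x ≠ 0) :
    ∃ n : ℤ, ν x = ν (ϖ : F) ^ n := by
  have key : ∀ x : F, x ≠ 0 → ν x ≤ 1 → ∃ n : ℕ, ν x = ν (ϖ : F) ^ n := by
    intro x hx h1
    obtain ⟨n, u, hu⟩ := IsDiscreteValuationRing.associated_pow_irreducible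
      (x := (⟨x, h1⟩ : 𝒪[F])) (fun h => hx (congrArg Subtype.val h)) hϖ
    have hv : x * ((u : 𝒪[F]) : F) = (ϖ : F) ^ n := congrArg Subtype.val hu
    have hu1 : ν ((u : 𝒪[F]) : F) = 1 :=
      (Valuation.integer.integers ν).isUnit_iff_valuation_eq_one.1 u.isUnit
    refine ⟨n, ?_⟩
    rw [← map_pow, ← hv, map_mul, hu1, mul_one]
  rcases le_total (ν x) 1 with h | h
  · obtain ⟨n, hn⟩ := key x hx h
    exact ⟨n, by rw [hn, zpow_natCast]⟩
  · obtain ⟨n, hn⟩ := key x⁻¹ (inv_ne_zero hx) (by rw [map_inv₀]; exact inv_le_one_of_one_le₀ h)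
    exact ⟨-n, by rw [zpow_neg, zpow_natCast, ← hn, map_inv₀, inv_inv]⟩

theorem exists_mul_scalarUniformizer_zpow_mem (hϖ : Irreducible ϖ) (g : KZ F) :
    ∃ n : ℤ, ((g * scalarUniformizer hϖ ^ n : KZ F) : GL (Fin 2) F) ∈ K F := by
  obtain ⟨i, j, hij⟩ := exists_matVal_eq g.1.val
  generalize g.1.val i j = a at hij
  have ha : a ≠ 0 := (ν).ne_zero_iff.1 (hij ▸ (matVal_pos g.1).ne')
  have hva : ν a ≠ 0 := (ν).ne_zero_iff.2 ha
  obtain ⟨n, hn⟩ := exists_val_eq_zpow hϖ ha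
  refine ⟨-n, ?_⟩
  have hϖ0 : (ϖ : F) ≠ 0 := by simpa using hϖ.ne_zero
  have hval : (g * scalarUniformizer hϖ ^ (-n) : KZ F).1.val = ((ϖ : F) ^ (-n)) • g.1.val := by
    have : ((scalarUniformizer hϖ ^ (-n) : KZ F) : GL (Fin 2) F) =
        Matrix.GeneralLinearGroup.scalar (Fin 2) (Units.mk0 (ϖ : F) hϖ0 ^ (-n)) := by
      rw [map_zpow]; rfl
    rw [Subgroup.coe_mul, this, val_mul_scalar, Units.val_zpow_eq_zpow_val, Units.val_mk0]
  have hdet : ν g.1.val.det = ν a ^ 2 :=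
    hij ▸ le_antisymm (val_det_le g.1.val) (mem_KZ_iff.1 g.2)
  have hϖn : ν ((ϖ : F) ^ (-n)) = (ν a)⁻¹ := by rw [map_zpow₀, zpow_neg, ← hn]
  apply mem_K_of_val
  · rw [hval, matVal_smul, hij, hϖn, inv_mul_cancel₀ hva]
  · rw [hval, Matrix.det_smul, Fintype.card_fin, map_mul, hdet, map_pow, hϖn, inv_pow,
      inv_mul_cancel₀ (pow_ne_zero 2 hva)]

theorem isCompact_K : IsCompact (K F : Set (GL (Fin 2) F)) := by
  have hcont : Continuous (Matrix.GeneralLinearGroup.map (n := Fin 2) (algebraMap 𝒪[F] F)) := by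
    refine Continuous.units_map _ ?_
    exact continuous_id.matrix_map continuous_subtype_val
  have hT : T1Space F := by
    let := IsTopologicalAddGroup.rightUniformSpace F
    have := isUniformAddGroup_of_addCommGroup (G := F)
    infer_instance
  have hT' : T1Space (Matrix (Fin 2) (Fin 2) 𝒪[F]) :=
    inferInstanceAs (T1Space (Fin 2 → Fin 2 → 𝒪[F]))
  have hc : CompactSpace (Matrix (Fin 2) (Fin 2) 𝒪[F]) :=
    inferInstanceAs (CompactSpace (Fin 2 → Fin 2 → 𝒪[F]))
  have hc' : CompactSpace (GL (Fin 2) 𝒪[F]) :=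
    inferInstanceAs (CompactSpace (Matrix (Fin 2) (Fin 2) 𝒪[F])ˣ)
  exact isCompact_range hcont

variable {k V : Type*} [Field k] [AddCommGroup V] [Module k V]

/-- The `K`-orbit of a nonzero vector is finite by smoothness and compactness. As `KZ` is generated
by `K` and the central scalar `ϖ`, the translates of this orbit by powers of `ϖ` form the full
orbit, which spans by irreducibility; `finiteDimensional_of_central` concludes. -/
theorem IsWeight.finiteDimensional {σ : Representation k (KZ F) V} (hσ : IsWeight σ)
    (hϖ : Irreducible ϖ) : FiniteDimensional k V := by
  by_cases hV : ∀ v : V, v = 0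
  · have : Subsingleton V := ⟨fun x y => by rw [hV x, hV y]⟩
    infer_instance
  push Not at hV
  obtain ⟨v, hv⟩ := hV
  obtain ⟨U, hU, hUv⟩ := hσ.smooth v
  let j : K F →* KZ F := Subgroup.inclusion le_sup_left
  have hj : Continuous j := continuous_subtype_val.subtype_mk _
  have hcpt : CompactSpace (K F) := isCompact_iff_compactSpace.1 isCompact_K
  have hquot : Finite (K F ⧸ U.comap j) :=
    Subgroup.quotient_finite_of_isOpen _ (hU.preimage hj)
  let s : Set V := Set.range fun q : K F ⧸ U.comap j => σ (j q.out) v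
  have hjs : ∀ x : K F, σ (j x) v ∈ s := by
    intro x
    refine ⟨(x : K F ⧸ U.comap j), ?_⟩
    obtain ⟨u, hu⟩ := QuotientGroup.mk_out_eq_mul (U.comap j) x
    show σ (j (Quotient.out _)) v = _
    rw [hu, map_mul, map_mul, Module.End.mul_apply, hUv _ u.2]
  refine finiteDimensional_of_central σ hσ.irreducible (scalarUniformizer_mul hϖ)
    (Set.finite_range _ : s.Finite) ?_
  let S := {x | ∃ n : ℤ, ∃ w ∈ s, x = σ (scalarUniformizer hϖ ^ n) w}
  have hgS : ∀ g : KZ F, σ g v ∈ S := by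
    intro g
    obtain ⟨n, hn⟩ := exists_mul_scalarUniformizer_zpow_mem hϖ g
    refine ⟨-n, _, hjs ⟨_, hn⟩, ?_⟩
    have hc : Commute (scalarUniformizer hϖ ^ (-n)) g :=
      Commute.zpow_left (scalarUniformizer_mul hϖ g) (-n)
    have : scalarUniformizer hϖ ^ (-n) * j ⟨_, hn⟩ = g := by
      show scalarUniformizer hϖ ^ (-n) * (g * scalarUniformizer hϖ ^ n) = g
      rw [← mul_assoc, hc.eq, mul_assoc, ← zpow_add, neg_add_cancel, zpow_zero, mul_one]
    rw [← Module.End.mul_apply, ← map_mul, this]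
  have hSg : ∀ x ∈ S, ∃ g : KZ F, x = σ g v := by
    rintro _ ⟨n, _, ⟨q, rfl⟩, rfl⟩
    exact ⟨_, by rw [← Module.End.mul_apply, ← map_mul]⟩
  let N : Subrepresentation σ :=
    { toSubmodule := Submodule.span k S
      apply_mem_toSubmodule := by
        intro g x hx
        have hle : Submodule.span k S ≤ (Submodule.span k S).comap (σ g) := by
          refine Submodule.span_le.2 fun x hx => ?_
          obtain ⟨g', rfl⟩ := hSg x hx
          refine Submodule.subset_span ?_
          rw [← Module.End.mul_apply, ← map_mul]
          exact hgS _
        exact hle hx }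
  have hvN : v ∈ N.toSubmodule := Submodule.subset_span (by simpa using hgS 1)
  rcases hσ.irreducible.eq_bot_or_eq_top N with h | h
  · rw [h] at hvN
    exact absurd hvN hv
  · exact congrArg Subrepresentation.toSubmodule h

theorem IPlus_eq_supportedOn (σ : Representation k (KZ F) V) :
    IPlus σ = supportedOn σ (halfTree F) :=
  span_bracket_eq_supportedOn isOpen_KZ isRightStable_halfTree PPlus_subset_halfTree
    fun _ hg => exists_mem_PPlus_inv_mul_mem_KZ hg

end Weights

end ModpGL2

end

theorem mainTheorem8 (p : ℕ) [Fact p.Prime]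
    {F : Type*} [Field F] [ValuativeRel F] [TopologicalSpace F] [IsNonarchimedeanLocalField F]
    [CharP 𝓀[F] p] (ϖ : 𝒪[F]) (hϖ : Irreducible ϖ)
    {k : Type*} [Field k] [IsAlgClosed k] [CharP k p]
    {V : Type*} [AddCommGroup V] [Module k V]
    (σ : Representation k (ModpGL2.KZ F) V) (hσ : ModpGL2.IsWeight σ)
    {W : Type*} [AddCommGroup W] [Module k W] (π : Representation k (GL (Fin 2) F) W)
    (φ : Representation.IntertwiningMap (ModpGL2.cInd (ModpGL2.KZ F) σ) π)
    (hφ : Function.Surjective φ) (hR : ModpGL2.R φ ≠ ⊥) :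
    FiniteDimensional k (ModpGL2.D1 ϖ hϖ φ) ↔ (ModpGL2.R φ).FG := by
  have := hσ.finiteDimensional hϖ
  have hS := ModpGL2.isHalfTree hϖ
  have hD : ModpGL2.D1 ϖ hϖ φ = ModpGL2.edgeSpace σ (ModpGL2.halfTree F) φ := by
    rw [ModpGL2.D1, ModpGL2.IMinus, ModpGL2.IPlus_eq_supportedOn, hS.map_supportedOn,
      ModpGL2.edgeSpace]
  rw [hD]
  exact ⟨hS.fg_ker_asSubmodule_of_finiteDimensional φ ModpGL2.isOpen_KZ,
    hS.finiteDimensional_edgeSpace_of_fg φ ModpGL2.isOpen_KZ⟩
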